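/- Conventions. Let $L=m+n$ qubits be split into the first $m$ (subsystem $A$) and the last $n$ (subsystem $B$), with $m,n\ge 0$ arbitrary, and put $r=\min(m,n)$, $s=\max(m,n)$, $D=2^L$. Let $\gamma_{2i-1}=Z_1\cdots Z_{i-1}X_i$, $\gamma_{2i}=Z_1\cdots Z_{i-1}Y_i$ be the Majorana operators, and $\gamma_X=\gamma_{x_1}\cdots\gamma_{x_p}$ for $X=\{x_1<\dots<x_p\}\subseteq\{1,\dots,2L\}$. A pure fermionic Gaussian state is a state $|\psi\rangle=U|0\cdots0\rangle$ with $U$ unitary such that $U^\dagger\gamma_\mu U=\sum_\nu O_{\mu\nu}\gamma_\nu$ for some $O\in O(2L)$. Its covariance matrix is $\Gamma_{\mu\nu}=-\tfrac i2\operatorname{Tr}([\gamma_\mu,\gamma_\nu]|\psi\rangle\langle\psi|)$, and $\Gamma_{AA}$ is its $2m\times 2m$ block on $A$. For $\alpha>0$, $\alpha\ne1$, the $\alpha$-stabilizer Rényi entropy of a state $\rho$ and the corresponding function of a covariance matrix are $$M_\alpha(\rho)=\frac1{1-\alpha}\log\sum_{P\in\{I,X,Y,Z\}^{\otimes L}}\Bigl(\frac{|\operatorname{Tr}(\rho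 P)|^2}{2^L}\Bigr)^{\alpha}-\log D,\qquad M_\alpha(\Gamma)=\frac1{1-\alpha}\log\sum_{X}\Bigl(\frac{\det\Gamma_X}{\det(\mathbb 1+\Gamma)}\Bigr)^{\alpha}-\log D,$$ where $X$ runs over all subsets of $\{1,\dots,2L\}$ and $\Gamma_X$ is the principal submatrix on $X$. The nonlocal entropy is $M^{\rm NL}_\alpha(\psi)=\min_{U_A,U_B}M_\alpha\bigl((U_A\otimes U_B)|\psi\rangle\bigr)$ over all unitaries $U_A$, $U_B$ on the qubits of $A$ and $B$. For $\alpha>0$ let $F_\alpha(\rho)=\sum_X|\operatorname{Tr}(\rho\gamma_X)|^{2\alpha}$ and $F_\alpha(\Gamma)=\sum_X|\operatorname{Pf}(\Gamma_X)|^{2\alpha}$, where $\operatorname{Pf}=0$ in odd dimensions. Theorem. Let $|\psi_\Gamma\rangle$ be a pure fermionic Gaussian state with covariance matrix $\Gamma$. There are numbers $\nu_1,\dots,\nu_r\in[0,1]$ such that the eigenvalues of the Hermitian matrix $i\Gamma_{AA}$, with multiplicity, are $\pm\nu_1,\dots,\pm\nu_r$ together with $\pm1$, each taken $m-r$ times (so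 for $m\le n$ the $\nu_k$ are the singular values of $i\Gamma_{AA}$, each pair of equal ones being listed once). Put $\mu_k=\sqrt{1-\nu_k^2}$, $J=\begin{pmatrix}0&1\\-1&0\end{pmatrix}$, $Z=\begin{pmatrix}1&0\\0&-1\end{pmatrix}$. Let $\Gamma_{\rm can}$ be the matrix in which, for $k\le r$, the $k$-th modes of $A$ and $B$ are joined in the block $$\Gamma_k=\begin{pmatrix}\nu_kJ&\mu_kZ\\-\mu_kZ&\nu_kJ\end{pmatrix},$$ each of the remaining $s-r$ modes of the larger subsystem carries a block $J$, and all other entries vanish. Then: 1. There are $O_A\in O(2m)$, $O_B\in O(2n)$ with $(O_A\oplus O_B)\,\Gamma\,(O_A\oplus O_B)^T=\Gamma_{\rm can}$. This rotation is implemented by a local unitary $U_A\otimes U_B$, i.e. $(U_A\otimes U_B)^\dagger\gamma_\mu(U_A\otimes U_B)=\sum_\nu(O_A\oplus O_B)_{\mu\nu}\gamma_\nu$, so that $|\psi_{\rm can}\rangle=(U_A\otimes U_B)|\psi_\Gamma\rangle$ has covariance matrix $\Gamma_{\rm can}$. 2. For every real $\alpha>0$, $$F_\alpha(|\psi_{\rm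 can}\rangle\langle\psi_{\rm can}|)=F_\alpha(\Gamma_{\rm can})=2^{s}\prod_{k=1}^{r}\bigl(1+\nu_k^{2\alpha}+\mu_k^{2\alpha}\bigr).$$ 3. For every real $\alpha>0$ with $\alpha\ne1$, the minimum defining $M_\alpha^{\rm NL}(\psi_\Gamma)$ is attained, and $$M^{\rm NL}_\alpha(\psi_\Gamma)\le M_\alpha(|\psi_{\rm can}\rangle\langle\psi_{\rm can}|)=M_\alpha(\Gamma_{\rm can})=\frac1{1-\alpha}\sum_{k=1}^{r}\log\frac{1+\nu_k^{2\alpha}+\mu_k^{2\alpha}}2 .$$ The numbers $\nu_k$, the rotations and the unitaries do not depend on $\alpha$. -/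

import Mathlib

open scoped Matrix Kronecker

noncomputable section

namespace FermionMagic

/-! ### Qubits, Pauli strings and Majorana operators

The Hilbert space of `L` qubits has the computational basis `Fin L → Fin 2`; operators are complex
matrices over that basis.  The `2 L` Majorana operators are indexed by `Fin (L * 2)`: the index
`μ` belongs to the site `μ.divNat` and is of type `X` or `Y` according to `μ.modNat`. -/

/-- The computational basis of `L` qubits. -/
abbrev Bits (L : ℕ) : Type := Fin L → Fin 2

/-- The one-qubit Pauli matrices `I, X, Y, Z`, in this order. -/
def pauli : Fin 4 → Matrix (Fin 2) (Fin 2) ℂ :=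
  ![1, !![0, 1; 1, 0], !![0, -Complex.I; Complex.I, 0], !![1, 0; 0, -1]]

/-- The Pauli string `P₁ ⊗ ⋯ ⊗ P_L`. -/
def pauliString {L : ℕ} (P : Fin L → Fin 4) : Matrix (Bits L) (Bits L) ℂ :=
  Matrix.of fun a b => ∏ i, pauli (P i) (a i) (b i)

/-- Majorana operators by the Jordan-Wigner mapping: `Z ⋯ Z X I ⋯ I` and `Z ⋯ Z Y I ⋯ I`. -/
def majorana {L : ℕ} (μ : Fin (L * 2)) : Matrix (Bits L) (Bits L) ℂ :=
  pauliString fun i =>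
    if i < μ.divNat then 3
    else if i = μ.divNat then (if μ.modNat = 0 then 1 else 2)
    else 0

/-- The Majorana string `γ_X = γ_{x₁} ⋯ γ_{x_p}` for `X = {x₁ < ⋯ < x_p}`. -/
def majoranaString {L : ℕ} (X : Finset (Fin (L * 2))) : Matrix (Bits L) (Bits L) ℂ :=
  ((X.sort (· ≤ ·)).map majorana).prod

/-- The density matrix `|ψ⟩⟨ψ|`. -/
def pureDensity {L : ℕ} (ψ : Bits L → ℂ) : Matrix (Bits L) (Bits L) ℂ :=
  Matrix.vecMulVec ψ (star ψ)

/-- The Fock vacuum `|0 ⋯ 0⟩`. -/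
def vacuum (L : ℕ) : Bits L → ℂ := Pi.single 0 1

/-! ### Gaussian unitaries, Gaussian states and covariance matrices -/

/-- The operator `U` rotates the vector of Majorana operators by `O`:
`U† γ_μ U = ∑_ν O_{μν} γ_ν`. -/
def RotatesMajoranas {L : ℕ} (U : Matrix (Bits L) (Bits L) ℂ)
    (O : Matrix (Fin (L * 2)) (Fin (L * 2)) ℝ) : Prop :=
  ∀ μ, star U * majorana μ * U = ∑ ν, (O μ ν : ℂ) • majorana ν

/-- Pure fermionic Gaussian states: the images of the Fock vacuum under the unitaries that rotate
the Majorana operators by an orthogonal matrix.  Rotations of determinant `1` give the states of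
even fermion parity, those of determinant `-1` the states of odd parity. -/
def IsPureGaussian {L : ℕ} (ψ : Bits L → ℂ) : Prop :=
  ∃ U ∈ Matrix.unitaryGroup (Bits L) ℂ, ∃ O ∈ Matrix.orthogonalGroup (Fin (L * 2)) ℝ,
    RotatesMajoranas U O ∧ ψ = U *ᵥ vacuum L

/-- The covariance matrix `Γ_{μν} = -(i/2) Tr([γ_μ, γ_ν] ρ)`; the right-hand side is real for a
Hermitian `ρ`. -/
def covariance {L : ℕ} (ρ : Matrix (Bits L) (Bits L) ℂ) :
    Matrix (Fin (L * 2)) (Fin (L * 2)) ℝ :=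
  Matrix.of fun μ ν =>
    (-(Complex.I / 2) *
      Matrix.trace ((majorana μ * majorana ν - majorana ν * majorana μ) * ρ)).re

/-! ### Stabilizer Rényi entropies -/

/-- The stabilizer Rényi entropy
`M_α(ρ) = (1 - α)⁻¹ log ∑_P (|Tr(ρ P)|² / 2^L)^α - log 2^L`. -/
def sre {L : ℕ} (α : ℝ) (ρ : Matrix (Bits L) (Bits L) ℂ) : ℝ :=
  1 / (1 - α) *
      Real.log (∑ P : Fin L → Fin 4, (‖Matrix.trace (ρ * pauliString P)‖ ^ 2 / 2 ^ L) ^ α)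
    - Real.log (2 ^ L)

/-- The stabilizer Rényi entropy of a Gaussian state as a function of its covariance matrix:
`M_α(Γ) = (1 - α)⁻¹ log ∑_X (det Γ_X / det(1 + Γ))^α - log 2^L`. -/
def sreCov {L : ℕ} (α : ℝ) (Γ : Matrix (Fin (L * 2)) (Fin (L * 2)) ℝ) : ℝ :=
  1 / (1 - α) *
      Real.log (∑ X : Finset (Fin (L * 2)),
        ((Γ.submatrix (fun x : X => (x : Fin (L * 2))) (fun x : X => (x : Fin (L * 2)))).det
          / (1 + Γ).det) ^ α)
    - Real.log (2 ^ L)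

/-- `F_α(ρ) = ∑_X |Tr(ρ γ_X)|^{2α}`, the sum over all Majorana strings. -/
def stringMoment {L : ℕ} (α : ℝ) (ρ : Matrix (Bits L) (Bits L) ℂ) : ℝ :=
  ∑ X : Finset (Fin (L * 2)), ‖Matrix.trace (ρ * majoranaString X)‖ ^ (2 * α)

/-- The Pfaffian of a skew-symmetric matrix, by expansion along the first row; it is zero in odd
dimensions. -/
def pfaffian : {N : ℕ} → Matrix (Fin N) (Fin N) ℝ → ℝ
  | 0, _ => 1
  | 1, _ => 0
  | N + 2, A => ∑ j : Fin (N + 1), (-1) ^ (j : ℕ) * A 0 j.succ *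
      pfaffian (A.submatrix (fun i => (j.succAbove i).succ) (fun i => (j.succAbove i).succ))

/-- `F_α(Γ) = ∑_X |Pf(Γ_X)|^{2α}`, where `Γ_X` is the principal submatrix on the ordered set `X`. -/
def pfaffianMoment {L : ℕ} (α : ℝ) (Γ : Matrix (Fin (L * 2)) (Fin (L * 2)) ℝ) : ℝ :=
  ∑ X : Finset (Fin (L * 2)),
    |pfaffian (Γ.submatrix (X.orderEmbOfFin rfl) (X.orderEmbOfFin rfl))| ^ (2 * α)

/-! ### The bipartition of `m + n` qubits into the first `m` (`A`) and the last `n` (`B`) -/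

/-- The operator `U_A ⊗ U_B`. -/
def localOp {m n : ℕ} (UA : Matrix (Bits m) (Bits m) ℂ) (UB : Matrix (Bits n) (Bits n) ℂ) :
    Matrix (Bits (m + n)) (Bits (m + n)) ℂ :=
  Matrix.of fun a b =>
    UA (fun i => a (Fin.castAdd n i)) (fun i => b (Fin.castAdd n i)) *
      UB (fun j => a (Fin.natAdd m j)) (fun j => b (Fin.natAdd m j))

/-- The values of `M_α` on the orbit of `|ψ⟩` under local unitaries `U_A ⊗ U_B`. -/
def localOrbitSRE {m n : ℕ} (α : ℝ) (ψ : Bits (m + n) → ℂ) : Set ℝ :=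
  {x | ∃ UA ∈ Matrix.unitaryGroup (Bits m) ℂ, ∃ UB ∈ Matrix.unitaryGroup (Bits n) ℂ,
    x = sre α (pureDensity (localOp UA UB *ᵥ ψ))}

/-- The nonlocal stabilizer Rényi entropy, the minimum of `M_α` over the local unitary orbit. -/
def nonlocalSRE {m n : ℕ} (α : ℝ) (ψ : Bits (m + n) → ℂ) : ℝ :=
  sInf (localOrbitSRE α ψ)

/-- The Majorana indices of `A` (first) and of `B` (last) among all of them. -/
def splitIndex (m n : ℕ) : Fin (m * 2) ⊕ Fin (n * 2) ≃ Fin ((m + n) * 2) :=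
  finSumFinEquiv.trans (finCongr (Nat.add_mul m n 2).symm)

/-- The diagonal block `Γ_AA`. -/
def blockA {m n : ℕ} (Γ : Matrix (Fin ((m + n) * 2)) (Fin ((m + n) * 2)) ℝ) :
    Matrix (Fin (m * 2)) (Fin (m * 2)) ℝ :=
  Γ.submatrix (fun i => splitIndex m n (Sum.inl i)) (fun i => splitIndex m n (Sum.inl i))

/-- The direct sum `O_A ⊕ O_B`. -/
def directSum {m n : ℕ} (OA : Matrix (Fin (m * 2)) (Fin (m * 2)) ℝ)
    (OB : Matrix (Fin (n * 2)) (Fin (n * 2)) ℝ) :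
    Matrix (Fin ((m + n) * 2)) (Fin ((m + n) * 2)) ℝ :=
  Matrix.reindex (splitIndex m n) (splitIndex m n) (Matrix.fromBlocks OA 0 0 OB)

/-! ### The bipartite canonical form -/

/-- The sequence `ν` continued by the constant `1`. -/
def padOne {r : ℕ} (ν : Fin r → ℝ) (k : ℕ) : ℝ := if h : k < r then ν ⟨k, h⟩ else 1

/-- `J = i Y`. -/
def matJ : Matrix (Fin 2) (Fin 2) ℝ := !![0, 1; -1, 0]

/-- The real Pauli matrix `Z`. -/
def matZ : Matrix (Fin 2) (Fin 2) ℝ := !![1, 0; 0, -1]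

/-- The diagonal block `⨁ ν_k J ⊕ ⨁ J` of the canonical form on a side with `p` modes. -/
def canDiag (p : ℕ) {r : ℕ} (ν : Fin r → ℝ) : Matrix (Fin (p * 2)) (Fin (p * 2)) ℝ :=
  Matrix.reindex finProdFinEquiv finProdFinEquiv
    (Matrix.diagonal (fun k : Fin p => padOne ν k) ⊗ₖ matJ)

/-- The off-diagonal block of the canonical form: `μ_k Z` with `μ_k = √(1 - ν_k²)` between the
`k`-th mode of `A` and the `k`-th mode of `B`, and zero elsewhere. -/
def canOff (m n : ℕ) {r : ℕ} (ν : Fin r → ℝ) : Matrix (Fin (m * 2)) (Fin (n * 2)) ℝ :=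
  Matrix.reindex finProdFinEquiv finProdFinEquiv
    ((Matrix.of fun (k : Fin m) (l : Fin n) =>
      if (k : ℕ) = (l : ℕ) then √(1 - padOne ν k ^ 2) else 0) ⊗ₖ matZ)

/-- The bipartite canonical form: the `k`-th modes of `A` and `B`, `k < min m n`, form the block
`[[ν_k J, μ_k Z], [-μ_k Z, ν_k J]]`, and each remaining mode of the larger side the block `J`.
All Majorana indices of `A` precede those of `B`. -/
def canonicalCov (m n : ℕ) (ν : Fin (min m n) → ℝ) :
    Matrix (Fin ((m + n) * 2)) (Fin ((m + n) * 2)) ℝ :=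
  Matrix.reindex (splitIndex m n) (splitIndex m n)
    (Matrix.fromBlocks (canDiag m ν) (canOff m n ν) (-(canOff m n ν)ᵀ) (canDiag n ν))

/-- `ν` is the nonnegative half of the spectrum of the Hermitian matrix `i Γ_AA`, apart from
`m - r` further eigenvalue pairs `±1`: the eigenvalues of `i Γ_AA`, with multiplicity, are
`±ν_1, …, ±ν_r` and `m - r` times `±1`. -/
def IsPositiveSpectrum {m r : ℕ} (ΓAA : Matrix (Fin (m * 2)) (Fin (m * 2)) ℝ)
    (ν : Fin r → ℝ) : Prop :=
  (∀ k, 0 ≤ ν k) ∧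
    (Complex.I • ΓAA.map Complex.ofReal).charpoly =
      (∏ k, (Polynomial.X - Polynomial.C (ν k : ℂ)) * (Polynomial.X + Polynomial.C (ν k : ℂ))) *
        ((Polynomial.X - 1) * (Polynomial.X + 1)) ^ (m - r)

end FermionMagic

end

open FermionMagic

namespace FermionMagic

/-! A pure Gaussian state is handled through linear annihilation relations: `ψ` is killed by every
operator `γ_μ + i ∑ Γ_{μν} γ_ν` (`IsGaussianWith`). The vacuum satisfies them with `Γ = ⨁ J`, and a
unitary that rotates the Majorana operators by `O` turns `Γ` into `O Γ Oᵀ`. The relations alone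
force `Γ` to be the covariance matrix, skew-symmetric with `Γ² = -1`. They also give Wick's theorem
(`expect_prod_mul`): expectations of Majorana products are Pfaffians up to a phase.

Canonical form. Write `Γ = [[A, C'], [-C, D]]` with `C` the adjoint of `C'`. Then `Γ² = -1` says `A²
= C'C - 1`, `DC = -CA` and their mirror images. Hence on an `A`-invariant plane where `A² = -ν²`
with `ν < 1`, the map `C` is `μ = √(1 - ν²)` times an isometry onto a `D`-invariant plane. These two
planes reduce `Γ`, so the normal form follows by splitting off one pair of modes at a time
(`exists_isModePair`, `IsSkewSplit.exists_normalForm`).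

Implementation. By Cartan–Dieudonné it suffices to implement reflections, and the reflection in `v`
is conjugation by the normalized `γ(v)` times the parity operator. The Majorana operators of `B`
carry the parity operator of `A` as a Jordan–Wigner string, so a sign caused by `U_A` has to be
absorbed in `U_B` (`exists_localOp_rotatesMajoranas`).

Moments. `Γ_can` does not couple different modes, so Wick's theorem makes expectations
multiplicative and the sum over `X` becomes a product over modes, each with at most four Majorana
operators. Since `ν² + μ² = 1`, a joined pair contributes `2 (1 + ν^{2α} + μ^{2α})` and an unpaired
mode contributes `2`.

Entropy. Pauli strings are Majorana strings up to phases, `|⟨γ_X⟩|² = det Γ_X` in the canonical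
form, and `det (1 + Γ) = 2^L`, so both entropies reduce to the moments. The minimum exists because a
continuous function is minimized over a compact set of pairs of unitaries; the canonical state lies
in the orbit, which gives the upper bound. -/

/-! ### Tensor products of one-qubit operators -/

/-- The tensor product of one-qubit operators. -/
def siteTensor {L : ℕ} (M : Fin L → Matrix (Fin 2) (Fin 2) ℂ) : Matrix (Bits L) (Bits L) ℂ :=
  Matrix.of fun a b => ∏ i, M i (a i) (b i)

lemma siteTensor_mul {L : ℕ} (M N : Fin L → Matrix (Fin 2) (Fin 2) ℂ) :
    siteTensor M * siteTensor N = siteTensor fun i => M i * N i := by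
  ext a b
  simp only [siteTensor, Matrix.mul_apply, Matrix.of_apply, Finset.prod_univ_sum,
    Fintype.piFinset_univ, Finset.prod_mul_distrib]

lemma siteTensor_one {L : ℕ} : siteTensor (fun _ : Fin L => 1) = 1 := by
  ext a b
  simp only [siteTensor, Matrix.of_apply, Matrix.one_apply]
  split_ifs with h
  · simp [h]
  · obtain ⟨i, hi⟩ := Function.ne_iff.mp h
    exact Finset.prod_eq_zero (Finset.mem_univ i) (by simp [hi])

lemma siteTensor_smul {L : ℕ} (c : Fin L → ℂ) (M : Fin L → Matrix (Fin 2) (Fin 2) ℂ) :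
    siteTensor (fun i => c i • M i) = (∏ i, c i) • siteTensor M := by
  ext a b
  simp [siteTensor, Finset.prod_mul_distrib]

lemma star_siteTensor {L : ℕ} (M : Fin L → Matrix (Fin 2) (Fin 2) ℂ) :
    star (siteTensor M) = siteTensor fun i => star (M i) := by
  ext a b
  simp [siteTensor, Matrix.star_apply]

/-! ### Pauli matrices and Majorana operators -/

lemma star_pauli (p : Fin 4) : star (pauli p) = pauli p := by
  fin_cases p <;> ext i j <;> fin_cases i <;> fin_cases j <;> simp [pauli, Matrix.star_apply]

lemma pauli_mul_self (p : Fin 4) : pauli p * pauli p = 1 := by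
  fin_cases p <;> ext i j <;> fin_cases i <;> fin_cases j <;> simp [pauli, Matrix.mul_apply]

lemma pauli_mul_comm_neg {p q : Fin 4} (hp : p ≠ 0) (hq : q ≠ 0) (hpq : p ≠ q) :
    pauli p * pauli q = (-1 : ℂ) • (pauli q * pauli p) := by
  have h : (p = 1 ∧ q = 2) ∨ (p = 2 ∧ q = 1) ∨ (p = 1 ∧ q = 3) ∨ (p = 3 ∧ q = 1) ∨
      (p = 2 ∧ q = 3) ∨ (p = 3 ∧ q = 2) := by omega
  rcases h with ⟨rfl, rfl⟩ | ⟨rfl, rfl⟩ | ⟨rfl, rfl⟩ | ⟨rfl, rfl⟩ | ⟨rfl, rfl⟩ | ⟨rfl, rfl⟩ <;>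
  ext i j <;> fin_cases i <;> fin_cases j <;> simp [pauli, Matrix.mul_apply]

/-- The Pauli letter of a Majorana operator at a site. -/
def majoranaLetter {L : ℕ} (μ : Fin (L * 2)) (i : Fin L) : Fin 4 :=
  if i < μ.divNat then 3
  else if i = μ.divNat then (if μ.modNat = 0 then 1 else 2)
  else 0

lemma majorana_eq {L : ℕ} (μ : Fin (L * 2)) :
    majorana μ = siteTensor fun i => pauli (majoranaLetter μ i) := rfl

lemma star_majorana {L : ℕ} (μ : Fin (L * 2)) : star (majorana μ) = majorana μ := by
  simp only [majorana_eq, star_siteTensor, star_pauli]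

lemma majorana_mul_self {L : ℕ} (μ : Fin (L * 2)) : majorana μ * majorana μ = 1 := by
  simp only [majorana_eq, siteTensor_mul, pauli_mul_self, siteTensor_one]

lemma divNat_modNat_ext {L : ℕ} {μ ν : Fin (L * 2)} (h₁ : μ.divNat = ν.divNat)
    (h₂ : μ.modNat = ν.modNat) : μ = ν :=
  finProdFinEquiv.symm.injective (Prod.ext h₁ h₂)

/-- Two site tensors whose letters anticommute at exactly one site anticommute. -/
lemma siteTensor_anticomm {L : ℕ} {P Q : Fin L → Fin 4} (s : Fin L)
    (hs : P s ≠ 0 ∧ Q s ≠ 0 ∧ P s ≠ Q s) (h : ∀ i ≠ s, P i = 0 ∨ Q i = 0 ∨ P i = Q i) :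
    siteTensor (fun i => pauli (P i)) * siteTensor (fun i => pauli (Q i))
      = -(siteTensor (fun i => pauli (Q i)) * siteTensor (fun i => pauli (P i))) := by
  rw [siteTensor_mul, siteTensor_mul]
  have : (fun i => pauli (P i) * pauli (Q i)) =
      fun i => (if i = s then (-1 : ℂ) else 1) • (pauli (Q i) * pauli (P i)) := by
    funext i
    split_ifs with hi
    · subst hi
      exact pauli_mul_comm_neg hs.1 hs.2.1 hs.2.2
    · have p0 : pauli 0 = 1 := rfl
      rcases h i hi with h | h | h <;> simp [h, p0]
  rw [this, siteTensor_smul]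
  simp

/-- The letters clash only at the smaller of the two sites: before it both are `Z`, after it one of
them is `I` or both are equal. At a common site the letters are `X` and `Y`. -/
lemma majorana_anticomm {L : ℕ} {μ ν : Fin (L * 2)} (h : μ ≠ ν) :
    majorana μ * majorana ν = -(majorana ν * majorana μ) := by
  rw [majorana_eq, majorana_eq]
  refine siteTensor_anticomm (min μ.divNat ν.divNat) ?_ ?_
  · rcases lt_trichotomy μ.divNat ν.divNat with h' | h' | h'
    · simp only [min_eq_left h'.le, majoranaLetter, if_pos h', lt_irrefl, if_false, if_true]
      split_ifs <;> decide
    · have h2 : μ.modNat ≠ ν.modNat := fun h2 => h (divNat_modNat_ext h' h2)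
      simp only [h', min_self, majoranaLetter, lt_irrefl, if_false, if_true]
      split_ifs with h3 h4 h4
      · exact absurd (h3.trans h4.symm) h2
      · decide
      · decide
      · exact absurd (by omega) h2
    · simp only [min_eq_right h'.le, majoranaLetter, if_pos h', lt_irrefl, if_false, if_true]
      split_ifs <;> decide
  · intro i hi
    simp only [majoranaLetter]
    rcases lt_trichotomy μ.divNat ν.divNat with h' | h' | h' <;>
    rcases lt_trichotomy i μ.divNat with h1 | h1 | h1 <;>
    rcases lt_trichotomy i ν.divNat with h2 | h2 | h2 <;>
    simp_all [not_lt_of_gt, ne_of_gt, le_of_lt]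

/-- The fermion parity operator `Z ⊗ ⋯ ⊗ Z`. -/
def parity (L : ℕ) : Matrix (Bits L) (Bits L) ℂ := siteTensor fun _ => pauli 3

lemma star_parity (L : ℕ) : star (parity L) = parity L := by
  simp only [parity, star_siteTensor, star_pauli]

lemma parity_mul_self (L : ℕ) : parity L * parity L = 1 := by
  simp only [parity, siteTensor_mul, pauli_mul_self, siteTensor_one]

lemma parity_majorana {L : ℕ} (μ : Fin (L * 2)) :
    parity L * majorana μ = -(majorana μ * parity L) := by
  rw [majorana_eq, parity]
  refine siteTensor_anticomm μ.divNat ?_ ?_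
  · simp only [majoranaLetter, lt_irrefl, if_false, if_true]
    split_ifs <;> decide
  · intro i hi
    simp only [majoranaLetter, hi, if_false]
    split_ifs <;> simp

/-- The operator `γ(v) = ∑ v_μ γ_μ`. -/
def majoranaVec {L : ℕ} (v : Fin (L * 2) → ℝ) : Matrix (Bits L) (Bits L) ℂ :=
  ∑ μ, (v μ : ℂ) • majorana μ

lemma star_majoranaVec {L : ℕ} (v : Fin (L * 2) → ℝ) : star (majoranaVec v) = majoranaVec v := by
  simp [majoranaVec, star_sum, star_smul, star_majorana]

lemma majorana_add_comm {L : ℕ} (μ ν : Fin (L * 2)) :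
    majorana μ * majorana ν + majorana ν * majorana μ = if μ = ν then 2 else 0 := by
  split_ifs with h
  · rw [h, majorana_mul_self, one_add_one_eq_two]
  · rw [majorana_anticomm h, neg_add_cancel]

lemma majoranaVec_add_comm {L : ℕ} (v : Fin (L * 2) → ℝ) (μ : Fin (L * 2)) :
    majoranaVec v * majorana μ + majorana μ * majoranaVec v = (2 * v μ : ℂ) • 1 := by
  simp only [majoranaVec, Finset.sum_mul, Finset.mul_sum, ← Finset.sum_add_distrib,
    smul_mul_assoc, mul_smul_comm, ← smul_add, majorana_add_comm, smul_ite, smul_zero,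
    Finset.sum_ite_eq', Finset.mem_univ, if_true]
  rw [mul_comm, mul_smul, two_smul ℂ (1 : Matrix (Bits L) (Bits L) ℂ), one_add_one_eq_two]

lemma majoranaVec_mul_self {L : ℕ} (v : Fin (L * 2) → ℝ) :
    majoranaVec v * majoranaVec v = ((∑ μ, v μ ^ 2 : ℝ) : ℂ) • 1 := by
  have h : (2 : ℂ) • (majoranaVec v * majoranaVec v) = (2 * ((∑ μ, v μ ^ 2 : ℝ) : ℂ)) • 1 := by
    rw [two_smul]
    calc majoranaVec v * majoranaVec v + majoranaVec v * majoranaVec v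
        = ∑ μ, (v μ : ℂ) • (majoranaVec v * majorana μ + majorana μ * majoranaVec v) := by
          conv_lhs => enter [1, 2]; rw [majoranaVec]
          conv_lhs => enter [2, 1]; rw [majoranaVec]
          simp only [smul_add, Finset.sum_add_distrib, Finset.mul_sum, Finset.sum_mul,
            mul_smul_comm, smul_mul_assoc]
      _ = _ := by
          simp only [majoranaVec_add_comm, smul_smul, ← Finset.sum_smul]
          congr 1
          push_cast
          rw [Finset.mul_sum]
          exact Finset.sum_congr rfl fun μ _ => by ring
  rw [mul_smul] at h
  exact smul_right_injective _ two_ne_zero h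

/-! ### Reordering products of Majorana operators -/

lemma majorana_prod_of_perm {L : ℕ} {l₁ l₂ : List (Fin (L * 2))} (h : l₁.Perm l₂) :
    l₁.Nodup → ((l₁.map majorana).prod = (l₂.map majorana).prod ∨
      (l₁.map majorana).prod = -(l₂.map majorana).prod) := by
  induction h with
  | nil => simp
  | cons x _ ih =>
    intro hn
    rcases ih (List.nodup_cons.mp hn).2 with h | h <;> simp [h]
  | swap x y l =>
    intro hn
    have hxy : y ≠ x := by
      intro h
      simp [h] at hn
    right
    simp only [List.map_cons, List.prod_cons, ← mul_assoc, majorana_anticomm hxy, neg_mul]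
  | trans h₁ _ ih₁ ih₂ =>
    intro hn
    rcases ih₁ hn with h | h <;> rcases ih₂ (h₁.nodup_iff.mp hn) with h' | h' <;> simp [h, h']

/-- Only absolute values of expectations matter below, so a string may be multiplied out in any
convenient order. -/
lemma majoranaString_eq_or_neg {L : ℕ} (l : List (Fin (L * 2))) (hl : l.Nodup) :
    majoranaString l.toFinset = (l.map majorana).prod ∨
      majoranaString l.toFinset = -(l.map majorana).prod := by
  refine majorana_prod_of_perm ?_ (Finset.sort_nodup _ _)
  exact (List.perm_ext_iff_of_nodup (Finset.sort_nodup _ _) hl).mpr fun a => by simp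

/-! ### Majorana strings are Pauli strings up to a phase -/

/-- The Pauli matrices up to phases form the Klein four-group. -/
def pauliCode : Fin 4 → ZMod 2 × ZMod 2 := ![(0, 0), (1, 0), (0, 1), (1, 1)]

lemma exists_pauli_mul (p q : Fin 4) : ∃ c : ℂ, ∃ r, ‖c‖ = 1 ∧
    pauliCode r = pauliCode p + pauliCode q ∧ pauli p * pauli q = c • pauli r := by
  have key : ∀ c : ℂ, ∀ r, ‖c‖ = 1 → pauliCode r = pauliCode p + pauliCode q →
      pauli p * pauli q = c • pauli r → ∃ c : ℂ, ∃ r, ‖c‖ = 1 ∧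
      pauliCode r = pauliCode p + pauliCode q ∧ pauli p * pauli q = c • pauli r :=
    fun c r h₁ h₂ h₃ => ⟨c, r, h₁, h₂, h₃⟩
  by_cases hp : p = 0
  · subst hp
    exact key 1 q (by simp) (by simp [pauliCode]) (by simp [pauli])
  by_cases hq : q = 0
  · subst hq
    exact key 1 p (by simp) (by simp [pauliCode]) (by simp [pauli])
  by_cases hpq : p = q
  · subst hpq
    refine key 1 0 (by simp) ?_ (by rw [pauli_mul_self]; simp [pauli])
    have two : ∀ p : Fin 4, pauliCode 0 = pauliCode p + pauliCode p := by decide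
    exact two p
  have h : (p = 1 ∧ q = 2) ∨ (p = 2 ∧ q = 1) ∨ (p = 1 ∧ q = 3) ∨ (p = 3 ∧ q = 1) ∨
      (p = 2 ∧ q = 3) ∨ (p = 3 ∧ q = 2) := by omega
  clear key
  rcases h with ⟨rfl, rfl⟩ | ⟨rfl, rfl⟩ | ⟨rfl, rfl⟩ | ⟨rfl, rfl⟩ | ⟨rfl, rfl⟩ | ⟨rfl, rfl⟩
  · refine ⟨Complex.I, 3, by simp, by decide, ?_⟩
    ext i j; fin_cases i <;> fin_cases j <;> simp [pauli, Matrix.mul_apply]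
  · refine ⟨-Complex.I, 3, by simp, by decide, ?_⟩
    ext i j; fin_cases i <;> fin_cases j <;> simp [pauli, Matrix.mul_apply]
  · refine ⟨-Complex.I, 2, by simp, by decide, ?_⟩
    ext i j; fin_cases i <;> fin_cases j <;> simp [pauli, Matrix.mul_apply]
  · refine ⟨Complex.I, 2, by simp, by decide, ?_⟩
    ext i j; fin_cases i <;> fin_cases j <;> simp [pauli, Matrix.mul_apply]
  · refine ⟨Complex.I, 1, by simp, by decide, ?_⟩
    ext i j; fin_cases i <;> fin_cases j <;> simp [pauli, Matrix.mul_apply]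
  · refine ⟨-Complex.I, 1, by simp, by decide, ?_⟩
    ext i j; fin_cases i <;> fin_cases j <;> simp [pauli, Matrix.mul_apply]

lemma exists_pauliString_mul {L : ℕ} (P Q : Fin L → Fin 4) : ∃ c : ℂ, ∃ R, ‖c‖ = 1 ∧
    (∀ i, pauliCode (R i) = pauliCode (P i) + pauliCode (Q i)) ∧
    pauliString P * pauliString Q = c • pauliString R := by
  choose c r hc hr h using fun i => exists_pauli_mul (P i) (Q i)
  refine ⟨∏ i, c i, r, by simp [hc], hr, ?_⟩
  change siteTensor _ * siteTensor _ = _ • siteTensor _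
  rw [siteTensor_mul, ← siteTensor_smul]
  simp only [h]

lemma exists_pauliString_list {L : ℕ} (l : List (Fin (L * 2))) :
    ∃ c : ℂ, ∃ R : Fin L → Fin 4, ‖c‖ = 1 ∧
      (∀ i, pauliCode (R i) = (l.map fun μ => pauliCode (majoranaLetter μ i)).sum) ∧
      (l.map majorana).prod = c • pauliString R := by
  induction l with
  | nil =>
    refine ⟨1, fun _ => 0, by simp, by simp [pauliCode], ?_⟩
    rw [List.map_nil, List.prod_nil, one_smul, ← siteTensor_one]
    rfl
  | cons μ l ih =>
    obtain ⟨c, R, hc, hR, h⟩ := ih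
    obtain ⟨c', R', hc', hR', h'⟩ := exists_pauliString_mul (majoranaLetter μ) R
    refine ⟨c * c', R', by simp [hc, hc'], ?_, ?_⟩
    · intro i
      rw [hR', hR, List.map_cons, List.sum_cons]
    · rw [List.map_cons, List.prod_cons, h, mul_smul, ← h', mul_smul_comm]
      rfl

lemma exists_pauliString_majoranaString {L : ℕ} (X : Finset (Fin (L * 2))) :
    ∃ c : ℂ, ∃ R : Fin L → Fin 4, ‖c‖ = 1 ∧
      (∀ i, pauliCode (R i) = ∑ μ ∈ X, pauliCode (majoranaLetter μ i)) ∧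
      majoranaString X = c • pauliString R := by
  obtain ⟨c, R, hc, hR, h⟩ := exists_pauliString_list (X.sort (· ≤ ·))
  refine ⟨c, R, hc, fun i => ?_, h⟩
  rw [hR, ← List.sum_toFinset _ (Finset.sort_nodup _ _), Finset.sort_toFinset]

/-- Triangularity: at the site of the largest `y ∈ Y`, operators of earlier sites act as `I`, and
the two types at that site have the independent codes `(1, 0)` and `(0, 1)`. The coordinate matching
the type of `y` therefore sees `y` alone. -/
lemma majorana_codes_independent {L : ℕ} (Y : Finset (Fin (L * 2)))
    (h : ∀ i, ∑ μ ∈ Y, pauliCode (majoranaLetter μ i) = 0) : Y = ∅ := by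
  by_contra hY
  obtain ⟨y, hy, hmax⟩ := Y.exists_max_image id (Finset.nonempty_iff_ne_empty.mpr hY)
  have hdiv : ∀ μ ∈ Y, μ.divNat ≤ y.divNat := fun μ hμ => by
    have := Fin.le_def.mp (hmax μ hμ)
    rw [Fin.le_def]
    exact Nat.div_le_div_right this
  have hlet : ∀ μ ∈ Y, majoranaLetter μ y.divNat =
      if y.divNat = μ.divNat then (if μ.modNat = 0 then 1 else 2) else 0 := fun μ hμ => by
    rw [majoranaLetter, if_neg (not_lt.mpr (hdiv μ hμ))]
  have hs := h y.divNat
  rcases (by omega : y.modNat = 0 ∨ y.modNat = 1) with hy0 | hy1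
  · have := congrArg Prod.fst hs
    rw [Prod.fst_sum, Finset.sum_eq_single y] at this
    · simp [hlet y hy, hy0, pauliCode] at this
    · intro μ hμ hne
      rw [hlet μ hμ]
      split_ifs with h1 h2
      · exact absurd (divNat_modNat_ext h1.symm (h2.trans hy0.symm)) hne
      · simp [pauliCode]
      · simp [pauliCode]
    · exact fun h => absurd hy h
  · have := congrArg Prod.snd hs
    rw [Prod.snd_sum, Finset.sum_eq_single y] at this
    · simp [hlet y hy, hy1, pauliCode] at this
    · intro μ hμ hne
      rw [hlet μ hμ]
      split_ifs with h1 h2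
      · simp [pauliCode]
      · exact absurd (divNat_modNat_ext h1.symm (by omega)) hne
      · simp [pauliCode]
    · exact fun h => absurd hy h

/-- The map from `X` to the Pauli string of `γ_X` is injective: equal strings give a vanishing code
sum over the symmetric difference, as the codes have characteristic two. Counting `4^L = 2^{2L}`
makes it bijective, and phases do not change the norms. -/
lemma sum_pauliString_eq_sum_majoranaString {L : ℕ} (f : ℝ → ℝ)
    (ρ : Matrix (Bits L) (Bits L) ℂ) :
    ∑ P : Fin L → Fin 4, f ‖Matrix.trace (ρ * pauliString P)‖ =
      ∑ X : Finset (Fin (L * 2)), f ‖Matrix.trace (ρ * majoranaString X)‖ := by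
  choose c R hc hR h using exists_pauliString_majoranaString (L := L)
  have hinj : Function.Injective R := by
    intro X X' hX
    rw [← symmDiff_eq_bot]
    refine majorana_codes_independent _ fun i => ?_
    have e : ∑ μ ∈ X, pauliCode (majoranaLetter μ i) =
        ∑ μ ∈ X', pauliCode (majoranaLetter μ i) := by rw [← hR, ← hR, hX]
    rw [← Finset.sum_sdiff (Finset.inter_subset_left (s₁ := X) (s₂ := X')),
      ← Finset.sum_sdiff (Finset.inter_subset_right (s₁ := X) (s₂ := X'))] at e
    have e' := add_right_cancel e
    rw [Finset.sdiff_inter_self_left, Finset.sdiff_inter_self_right] at e'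
    have : symmDiff X X' = X \ X' ∪ X' \ X := rfl
    rw [this, Finset.sum_union disjoint_sdiff_sdiff, e']
    have two : ∀ z : ZMod 2 × ZMod 2, z + z = 0 := by decide
    exact two _
  have hbij : Function.Bijective R := by
    refine (Fintype.bijective_iff_injective_and_card R).mpr ⟨hinj, ?_⟩
    simp [pow_mul']
  refine (Fintype.sum_bijective R hbij _ _ fun X => ?_).symm
  rw [h, mul_smul_comm, Matrix.trace_smul, norm_smul, hc, one_mul]

/-! ### Unitaries implementing orthogonal transformations -/

lemma majoranaVec_single {L : ℕ} (μ : Fin (L * 2)) :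
    majoranaVec (Pi.single μ 1) = majorana μ := by
  simp [majoranaVec, Pi.single_apply]

lemma majoranaVec_add {L : ℕ} (v w : Fin (L * 2) → ℝ) :
    majoranaVec (v + w) = majoranaVec v + majoranaVec w := by
  simp [majoranaVec, add_smul, Finset.sum_add_distrib]

lemma majoranaVec_smul {L : ℕ} (c : ℝ) (v : Fin (L * 2) → ℝ) :
    majoranaVec (c • v) = (c : ℂ) • majoranaVec v := by
  simp [majoranaVec, mul_smul, Finset.smul_sum]

lemma majoranaVec_vecMul {L : ℕ} (v : Fin (L * 2) → ℝ)
    (M : Matrix (Fin (L * 2)) (Fin (L * 2)) ℝ) :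
    majoranaVec (v ᵥ* M) = ∑ μ, (v μ : ℂ) • majoranaVec (M μ) := by
  simp only [majoranaVec, Matrix.vecMul, dotProduct, Complex.ofReal_sum, Finset.sum_smul,
    Finset.smul_sum, smul_smul, Complex.ofReal_mul]
  exact Finset.sum_comm

lemma rotatesMajoranas_iff {L : ℕ} {U : Matrix (Bits L) (Bits L) ℂ}
    {O : Matrix (Fin (L * 2)) (Fin (L * 2)) ℝ} :
    RotatesMajoranas U O ↔ ∀ μ, star U * majorana μ * U = majoranaVec (O μ) := Iff.rfl

lemma majoranaVec_add_comm' {L : ℕ} (v w : Fin (L * 2) → ℝ) :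
    majoranaVec v * majoranaVec w + majoranaVec w * majoranaVec v = (2 * (v ⬝ᵥ w) : ℂ) • 1 := by
  have h : ∀ x : Fin (L * 2) → ℝ, majoranaVec x = ∑ μ, (x μ : ℂ) • majorana μ := fun _ => rfl
  rw [h w, Finset.mul_sum, Finset.sum_mul, ← Finset.sum_add_distrib]
  simp only [mul_smul_comm, smul_mul_assoc, ← smul_add, majoranaVec_add_comm, smul_smul,
    ← Finset.sum_smul]
  congr 1
  simp only [dotProduct, Complex.ofReal_sum, Complex.ofReal_mul, Finset.mul_sum]
  exact Finset.sum_congr rfl fun μ _ => by ring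

lemma parity_majoranaVec {L : ℕ} (v : Fin (L * 2) → ℝ) :
    parity L * majoranaVec v = -(majoranaVec v * parity L) := by
  simp only [majoranaVec, Finset.mul_sum, Finset.sum_mul, mul_smul_comm, smul_mul_assoc,
    parity_majorana, smul_neg, Finset.sum_neg_distrib]

/-- The orthogonal transformation `φ` is implemented by a unitary of definite parity. -/
def IsImplemented {L : ℕ}
    (φ : EuclideanSpace ℝ (Fin (L * 2)) ≃ₗᵢ[ℝ] EuclideanSpace ℝ (Fin (L * 2))) : Prop :=
  ∃ U ∈ Matrix.unitaryGroup (Bits L) ℂ,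
    (∀ x : EuclideanSpace ℝ (Fin (L * 2)), star U * majoranaVec x * U = majoranaVec (φ x)) ∧
    (star U * parity L * U = parity L ∨ star U * parity L * U = -parity L)

lemma isImplemented_one {L : ℕ} : IsImplemented (L := L) 1 :=
  ⟨1, one_mem _, fun x => by simp, Or.inl (by simp)⟩

lemma IsImplemented.mul {L : ℕ}
    {φ₁ φ₂ : EuclideanSpace ℝ (Fin (L * 2)) ≃ₗᵢ[ℝ] EuclideanSpace ℝ (Fin (L * 2))}
    (h₁ : IsImplemented φ₁) (h₂ : IsImplemented φ₂) : IsImplemented (φ₁ * φ₂) := by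
  obtain ⟨U₁, hU₁, h₁, p₁⟩ := h₁
  obtain ⟨U₂, hU₂, h₂, p₂⟩ := h₂
  have conj : ∀ M, star (U₂ * U₁) * M * (U₂ * U₁) = star U₁ * (star U₂ * M * U₂) * U₁ := by
    intro M
    simp only [star_mul, mul_assoc]
  -- The order is reversed because `U ↦ U† · U` is contravariant.
  refine ⟨U₂ * U₁, mul_mem hU₂ hU₁, fun x => ?_, ?_⟩
  · rw [conj, h₂, h₁]
    rfl
  · rw [conj]
    rcases p₂ with p₂ | p₂ <;> rcases p₁ with p₁ | p₁ <;> simp [p₁, p₂]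

/-- Conjugation by `γ(v) / ‖v‖` fixes `γ(v)` and negates `γ(w)` for `w ⊥ v`, which is minus the
reflection. The extra factor of parity, which anticommutes with every `γ(w)`, corrects this sign. -/
lemma isImplemented_reflection {L : ℕ} (v : EuclideanSpace ℝ (Fin (L * 2))) :
    IsImplemented (Submodule.reflection (ℝ ∙ v)ᗮ) := by
  by_cases hv : v = 0
  · subst hv
    convert isImplemented_one
    ext1 x
    rw [Submodule.reflection_orthogonal_apply, Submodule.reflection_singleton_apply]
    simp
  have hv2 : (‖v‖ : ℝ) ^ 2 ≠ 0 := pow_ne_zero _ (norm_ne_zero_iff.mpr hv)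
  have hvv : majoranaVec v * majoranaVec v = ((‖v‖ ^ 2 : ℝ) : ℂ) • 1 := by
    rw [majoranaVec_mul_self, EuclideanSpace.real_norm_sq_eq]
  have hu : ((‖v‖⁻¹ : ℝ) : ℂ) * ((‖v‖⁻¹ : ℝ) : ℂ) * ((‖v‖ ^ 2 : ℝ) : ℂ) = 1 := by
    rw [← Complex.ofReal_mul, ← Complex.ofReal_mul]
    norm_cast
    field_simp
  have hstar : star (((‖v‖⁻¹ : ℝ) : ℂ) • (majoranaVec v * parity L)) =
      ((‖v‖⁻¹ : ℝ) : ℂ) • (parity L * majoranaVec v) := by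
    rw [star_smul, star_mul, star_parity, star_majoranaVec]
    congr 1
    exact Complex.conj_ofReal _
  have hPVP : ∀ w : Fin (L * 2) → ℝ, parity L * (majoranaVec w * parity L) = -majoranaVec w :=
    fun w => by rw [← mul_assoc, parity_majoranaVec, neg_mul, mul_assoc, parity_mul_self, mul_one]
  have hVV : ∀ M, majoranaVec v * (majoranaVec v * M) = ((‖v‖ ^ 2 : ℝ) : ℂ) • M := fun M => by
    rw [← mul_assoc, hvv, smul_mul_assoc, one_mul]
  refine ⟨((‖v‖⁻¹ : ℝ) : ℂ) • (majoranaVec v * parity L), ?_, fun x => ?_, Or.inr ?_⟩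
  · rw [Matrix.mem_unitaryGroup_iff', hstar, smul_mul_smul_comm, mul_assoc, hVV,
      mul_smul_comm, smul_smul, hu, one_smul, parity_mul_self]
  · rw [hstar, smul_mul_assoc, smul_mul_smul_comm]
    have hx : majoranaVec x * (majoranaVec v * parity L) =
        (2 * (v ⬝ᵥ x) : ℂ) • parity L - majoranaVec v * (majoranaVec x * parity L) := by
      rw [eq_sub_iff_add_eq, add_comm, ← mul_assoc, ← mul_assoc, ← add_mul,
        majoranaVec_add_comm', smul_mul_assoc, one_mul]
    rw [mul_assoc, mul_assoc, hx, mul_sub, hVV, mul_sub, mul_smul_comm, mul_smul_comm,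
      mul_smul_comm, hPVP, hPVP, smul_sub, smul_smul, smul_smul, hu, one_smul]
    rw [Submodule.reflection_orthogonal_apply, Submodule.reflection_singleton_apply]
    have hr : (-(2 • (inner ℝ v x / (‖v‖ : ℝ) ^ 2) • v - x) : EuclideanSpace ℝ (Fin (L * 2))).ofLp
        = x.ofLp + (-(‖v‖⁻¹ * ‖v‖⁻¹ * (2 * (v.ofLp ⬝ᵥ x.ofLp)))) • v.ofLp := by
      have hi : inner ℝ v x = v.ofLp ⬝ᵥ x.ofLp := by
        rw [PiLp.inner_apply, dotProduct]
        exact Finset.sum_congr rfl fun i _ => by simp [mul_comm]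
      ext i
      simp [hi]
      field_simp
      ring
    erw [hr]
    rw [majoranaVec_add, majoranaVec_smul]
    push_cast
    simp only [smul_neg, neg_smul]
    abel
  · rw [hstar, smul_mul_assoc, smul_mul_smul_comm]
    rw [mul_assoc, mul_assoc, ← mul_assoc (parity L) (majoranaVec v) (parity L),
      parity_majoranaVec, neg_mul, mul_assoc, parity_mul_self, mul_one, mul_neg, hvv, mul_neg,
      smul_neg, mul_smul_comm, smul_smul, hu, one_smul, mul_one]

/-- Cartan–Dieudonné: every isometry is a product of reflections. -/
lemma isImplemented {L : ℕ}
    (φ : EuclideanSpace ℝ (Fin (L * 2)) ≃ₗᵢ[ℝ] EuclideanSpace ℝ (Fin (L * 2))) :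
    IsImplemented φ := by
  obtain ⟨l, -, rfl⟩ := φ.reflections_generate_dim
  induction l with
  | nil => exact isImplemented_one
  | cons v l ih =>
    rw [List.map_cons, List.prod_cons]
    exact (isImplemented_reflection v).mul ih

/-- The isometry to implement sends the standard basis to the rows of `O`. The effect on parity is
recorded because the parity of `A` enters the Majorana operators of `B`. -/
lemma exists_unitary_rotatesMajoranas {L : ℕ} {O : Matrix (Fin (L * 2)) (Fin (L * 2)) ℝ}
    (hO : O ∈ Matrix.orthogonalGroup (Fin (L * 2)) ℝ) :
    ∃ U ∈ Matrix.unitaryGroup (Bits L) ℂ, RotatesMajoranas U O ∧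
      (star U * parity L * U = parity L ∨ star U * parity L * U = -parity L) := by
  have hO' := Matrix.mem_unitaryGroup_iff.mp hO
  have hon : Orthonormal ℝ (fun μ => WithLp.toLp 2 (O μ) : Fin (L * 2) → EuclideanSpace ℝ _) := by
    rw [orthonormal_iff_ite]
    intro i j
    have := congrFun (congrFun hO' j) i
    rw [Matrix.mul_apply, Matrix.one_apply] at this
    simp only [PiLp.inner_apply]
    simp only [eq_comm (a := i), ← this]
    exact Finset.sum_congr rfl fun k _ => by simp [Matrix.star_apply]
  let b := OrthonormalBasis.mk hon
    (hon.linearIndependent.span_eq_top_of_card_eq_finrank' (by simp)).ge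
  obtain ⟨U, hU, h, hp⟩ := isImplemented ((EuclideanSpace.basisFun (Fin (L * 2)) ℝ).equiv b
    (Equiv.refl _))
  refine ⟨U, hU, rotatesMajoranas_iff.mpr fun μ => ?_, hp⟩
  have := h (EuclideanSpace.basisFun (Fin (L * 2)) ℝ μ)
  rw [OrthonormalBasis.equiv_apply_basis] at this
  have e : (b μ).ofLp = O μ := by simp [b]
  simpa [e, majoranaVec_single, EuclideanSpace.basisFun_apply, EuclideanSpace.single] using this

/-! ### Local operators -/

lemma localOp_mul {m n : ℕ} (A C : Matrix (Bits m) (Bits m) ℂ) (B D : Matrix (Bits n) (Bits n) ℂ) :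
    localOp A B * localOp C D = localOp (A * C) (B * D) := by
  ext a b
  simp only [localOp, Matrix.mul_apply, Matrix.of_apply]
  rw [← (Fin.appendEquiv m n).sum_comp, Fintype.sum_prod_type, Finset.sum_mul_sum]
  refine Finset.sum_congr rfl fun x _ => Finset.sum_congr rfl fun y _ => ?_
  simp [Fin.appendEquiv]
  ring

lemma star_localOp {m n : ℕ} (A : Matrix (Bits m) (Bits m) ℂ) (B : Matrix (Bits n) (Bits n) ℂ) :
    star (localOp A B) = localOp (star A) (star B) := by
  ext a b
  simp [localOp, Matrix.star_apply]

lemma localOp_one {m n : ℕ} : localOp (1 : Matrix (Bits m) (Bits m) ℂ)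
    (1 : Matrix (Bits n) (Bits n) ℂ) = 1 := by
  ext a b
  simp only [localOp, Matrix.of_apply, Matrix.one_apply]
  by_cases h : a = b
  · simp [h]
  · rw [if_neg h]
    by_contra h'
    apply h
    have h1 := left_ne_zero_of_mul h'
    have h2 := right_ne_zero_of_mul h'
    simp only [ne_eq, ite_eq_right_iff, one_ne_zero, imp_false, not_not] at h1 h2
    funext i
    refine Fin.addCases (fun i => congrFun h1 i) (fun i => congrFun h2 i) i

lemma localOp_mem_unitaryGroup {m n : ℕ} {UA : Matrix (Bits m) (Bits m) ℂ}
    {UB : Matrix (Bits n) (Bits n) ℂ} (hA : UA ∈ Matrix.unitaryGroup (Bits m) ℂ)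
    (hB : UB ∈ Matrix.unitaryGroup (Bits n) ℂ) :
    localOp UA UB ∈ Matrix.unitaryGroup (Bits (m + n)) ℂ := by
  rw [Matrix.mem_unitaryGroup_iff, star_localOp, localOp_mul, Matrix.mem_unitaryGroup_iff.mp hA,
    Matrix.mem_unitaryGroup_iff.mp hB, localOp_one]

lemma siteTensor_append {m n : ℕ} (M : Fin (m + n) → Matrix (Fin 2) (Fin 2) ℂ) :
    siteTensor M = localOp (siteTensor fun i => M (Fin.castAdd n i))
      (siteTensor fun j => M (Fin.natAdd m j)) := by
  ext a b
  simp [siteTensor, localOp, Fin.prod_univ_add]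

lemma splitIndex_inl_val {m n : ℕ} (i : Fin (m * 2)) : (splitIndex m n (Sum.inl i) : ℕ) = i := by
  simp [splitIndex]

lemma splitIndex_inr_val {m n : ℕ} (j : Fin (n * 2)) :
    (splitIndex m n (Sum.inr j) : ℕ) = m * 2 + j := by
  simp [splitIndex]

lemma divNat_splitIndex_inl {m n : ℕ} (i : Fin (m * 2)) :
    (splitIndex m n (Sum.inl i)).divNat = Fin.castAdd n i.divNat := by
  ext
  simp [Fin.divNat, splitIndex_inl_val]

lemma modNat_splitIndex_inl {m n : ℕ} (i : Fin (m * 2)) :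
    (splitIndex m n (Sum.inl i)).modNat = i.modNat := by
  ext
  simp [Fin.modNat, splitIndex_inl_val]

lemma divNat_splitIndex_inr {m n : ℕ} (j : Fin (n * 2)) :
    (splitIndex m n (Sum.inr j)).divNat = Fin.natAdd m j.divNat := by
  ext
  simp only [Fin.divNat, splitIndex_inr_val, Fin.val_natAdd]
  omega

lemma modNat_splitIndex_inr {m n : ℕ} (j : Fin (n * 2)) :
    (splitIndex m n (Sum.inr j)).modNat = j.modNat := by
  ext
  simp only [Fin.modNat, splitIndex_inr_val]
  omega

lemma majorana_splitIndex_inl {m n : ℕ} (i : Fin (m * 2)) :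
    majorana (splitIndex m n (Sum.inl i)) = localOp (majorana i) 1 := by
  rw [majorana_eq, siteTensor_append, majorana_eq, ← siteTensor_one]
  have p0 : pauli 0 = 1 := rfl
  congr 3 <;> funext k
  · rw [majoranaLetter, majoranaLetter, divNat_splitIndex_inl, modNat_splitIndex_inl]
    simp [Fin.ext_iff, Fin.lt_def]
  · have h1 : ¬ (m + (k : ℕ) < i / 2) := by omega
    have h2 : ¬ (m + (k : ℕ) = i / 2) := by omega
    rw [majoranaLetter, divNat_splitIndex_inl, modNat_splitIndex_inl]
    simp [Fin.ext_iff, Fin.lt_def, h1, h2, p0]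

/-- The Jordan–Wigner string of a site in `B` runs over the whole of `A`. -/
lemma majorana_splitIndex_inr {m n : ℕ} (j : Fin (n * 2)) :
    majorana (splitIndex m n (Sum.inr j)) = localOp (parity m) (majorana j) := by
  rw [majorana_eq, siteTensor_append, majorana_eq, parity]
  congr 3 <;> funext k
  · have h1 : (k : ℕ) < m + j / 2 := by omega
    rw [majoranaLetter, divNat_splitIndex_inr, modNat_splitIndex_inr]
    simp [Fin.lt_def, h1]
  · rw [majoranaLetter, majoranaLetter, divNat_splitIndex_inr, modNat_splitIndex_inr]
    simp [Fin.ext_iff, Fin.lt_def]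

lemma localOp_sum_left {m n : ℕ} {ι : Type*} (s : Finset ι) (c : ι → ℂ)
    (A : ι → Matrix (Bits m) (Bits m) ℂ) (B : Matrix (Bits n) (Bits n) ℂ) :
    localOp (∑ i ∈ s, c i • A i) B = ∑ i ∈ s, c i • localOp (A i) B := by
  ext a b
  simp [localOp, Matrix.sum_apply, Finset.sum_mul, mul_assoc]

lemma localOp_sum_right {m n : ℕ} {ι : Type*} (s : Finset ι) (c : ι → ℂ)
    (A : Matrix (Bits m) (Bits m) ℂ) (B : ι → Matrix (Bits n) (Bits n) ℂ) :
    localOp A (∑ i ∈ s, c i • B i) = ∑ i ∈ s, c i • localOp A (B i) := by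
  ext a b
  simp [localOp, Matrix.sum_apply, Finset.mul_sum, mul_left_comm]

lemma directSum_mem_orthogonalGroup {m n : ℕ} {OA : Matrix (Fin (m * 2)) (Fin (m * 2)) ℝ}
    {OB : Matrix (Fin (n * 2)) (Fin (n * 2)) ℝ} (hA : OA ∈ Matrix.orthogonalGroup (Fin (m * 2)) ℝ)
    (hB : OB ∈ Matrix.orthogonalGroup (Fin (n * 2)) ℝ) :
    directSum OA OB ∈ Matrix.orthogonalGroup (Fin ((m + n) * 2)) ℝ := by
  have hA' := Matrix.mem_unitaryGroup_iff.mp hA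
  have hB' := Matrix.mem_unitaryGroup_iff.mp hB
  rw [Matrix.star_eq_conjTranspose, Matrix.conjTranspose_eq_transpose_of_trivial] at hA' hB'
  rw [Matrix.mem_unitaryGroup_iff, Matrix.star_eq_conjTranspose, directSum,
    Matrix.conjTranspose_reindex, Matrix.reindex_apply, Matrix.reindex_apply,
    Matrix.submatrix_mul_equiv, Matrix.fromBlocks_conjTranspose, Matrix.fromBlocks_multiply]
  simp [hA', hB']

/-- Conjugation by `U_A` may flip the parity factor `P_A` in the Majorana operators of `B`. In that
case `U_B` is chosen to implement `-O_B`, and the two signs cancel. -/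
lemma exists_localOp_rotatesMajoranas {m n : ℕ} {OA : Matrix (Fin (m * 2)) (Fin (m * 2)) ℝ}
    {OB : Matrix (Fin (n * 2)) (Fin (n * 2)) ℝ} (hA : OA ∈ Matrix.orthogonalGroup (Fin (m * 2)) ℝ)
    (hB : OB ∈ Matrix.orthogonalGroup (Fin (n * 2)) ℝ) :
    ∃ UA ∈ Matrix.unitaryGroup (Bits m) ℂ, ∃ UB ∈ Matrix.unitaryGroup (Bits n) ℂ,
      RotatesMajoranas (localOp UA UB) (directSum OA OB) := by
  obtain ⟨UA, hUA, rA, pA⟩ := exists_unitary_rotatesMajoranas hA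
  have key : ∃ UB ∈ Matrix.unitaryGroup (Bits n) ℂ, ∀ j,
      localOp (star UA * parity m * UA) (star UB * majorana j * UB) =
        localOp (parity m) (∑ k, (OB j k : ℂ) • majorana k) := by
    rcases pA with pA | pA
    · obtain ⟨UB, hUB, rB, -⟩ := exists_unitary_rotatesMajoranas hB
      exact ⟨UB, hUB, fun j => by rw [pA, rB]⟩
    · have hB' : -OB ∈ Matrix.orthogonalGroup (Fin (n * 2)) ℝ := by
        rw [Matrix.mem_unitaryGroup_iff, star_neg, neg_mul_neg]
        exact Matrix.mem_unitaryGroup_iff.mp hB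
      obtain ⟨UB, hUB, rB, -⟩ := exists_unitary_rotatesMajoranas hB'
      refine ⟨UB, hUB, fun j => ?_⟩
      rw [pA, rB]
      ext a b
      simp [localOp]
  obtain ⟨UB, hUB, rB⟩ := key
  refine ⟨UA, hUA, UB, hUB, fun μ => ?_⟩
  obtain ⟨μ, rfl⟩ := (splitIndex m n).surjective μ
  rw [← (splitIndex m n).sum_comp, Fintype.sum_sum_type, star_localOp]
  rcases μ with i | j
  · rw [majorana_splitIndex_inl, localOp_mul, localOp_mul, rA, mul_one,
      Matrix.mem_unitaryGroup_iff'.mp hUB, localOp_sum_left]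
    simp [directSum, majorana_splitIndex_inl]
  · rw [majorana_splitIndex_inr, localOp_mul, localOp_mul, rB, localOp_sum_right]
    simp [directSum, majorana_splitIndex_inr]

/-! ### The annihilation relations of a Gaussian state -/

/-- The state `ψ` is normalized and annihilated by all operators `γ_μ + i ∑ Γ_{μν} γ_ν`. -/
structure IsGaussianWith {L : ℕ} (ψ : Bits L → ℂ) (Γ : Matrix (Fin (L * 2)) (Fin (L * 2)) ℝ) :
    Prop where
  norm_eq : star ψ ⬝ᵥ ψ = 1
  majorana_mulVec : ∀ μ, majorana μ *ᵥ ψ = -Complex.I • (majoranaVec (Γ μ) *ᵥ ψ)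

/-- With an empty family `padOne` is constantly `1`, so `canDiag` is here the matrix `⨁ J`. -/
lemma isGaussianWith_vacuum (L : ℕ) :
    IsGaussianWith (vacuum L) (canDiag L (Fin.elim0 : Fin 0 → ℝ)) where
  norm_eq := by simp [vacuum]
  majorana_mulVec μ := by
    -- This is `Y|0⟩ = i X|0⟩` at site `i`; the two operators agree at all other sites.
    have h01 : ∀ i : Fin L, majorana (finProdFinEquiv (i, 1)) *ᵥ vacuum L =
        Complex.I • (majorana (finProdFinEquiv (i, 0)) *ᵥ vacuum L) := by
      intro i
      ext b
      simp only [vacuum, Matrix.mulVec_single_one, Pi.smul_apply, smul_eq_mul, Matrix.col_apply]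
      simp only [majorana_eq, siteTensor, Matrix.of_apply]
      rw [← Finset.mul_prod_erase _ _ (Finset.mem_univ i),
        ← Finset.mul_prod_erase _ _ (Finset.mem_univ i), ← mul_assoc]
      have hd : ∀ c : Fin 2, (finProdFinEquiv (i, c)).divNat = i := fun c =>
        congrArg Prod.fst (finProdFinEquiv.symm_apply_apply (i, c))
      have hm : ∀ c : Fin 2, (finProdFinEquiv (i, c)).modNat = c := fun c =>
        congrArg Prod.snd (finProdFinEquiv.symm_apply_apply (i, c))
      congr 1
      · simp only [majoranaLetter, hd, hm]
        rcases (by omega : b i = 0 ∨ b i = 1) with h | h <;> simp [h, pauli]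
      · refine Finset.prod_congr rfl fun j hj => ?_
        simp only [majoranaLetter, hd, if_neg (Finset.ne_of_mem_erase hj)]
    obtain ⟨⟨i, a⟩, rfl⟩ := finProdFinEquiv.surjective μ
    have hsum : majoranaVec (canDiag L (Fin.elim0 : Fin 0 → ℝ) (finProdFinEquiv (i, a))) =
        (matJ a 0 : ℂ) • majorana (finProdFinEquiv (i, 0)) +
          (matJ a 1 : ℂ) • majorana (finProdFinEquiv (i, 1)) := by
      rw [majoranaVec, ← finProdFinEquiv.sum_comp, Fintype.sum_prod_type]
      rw [Finset.sum_eq_single i]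
      · simp [canDiag, Matrix.kroneckerMap_apply, padOne]
      · intro j _ hj
        simp [canDiag, Matrix.kroneckerMap_apply, hj.symm]
      · simp
    rw [hsum, Matrix.add_mulVec, Matrix.smul_mulVec, Matrix.smul_mulVec, h01 i]
    rcases (by omega : a = 0 ∨ a = 1) with rfl | rfl
    · simp [matJ, smul_smul]
    · simp [matJ, h01]

lemma IsGaussianWith.majoranaVec_mulVec {L : ℕ} {ψ : Bits L → ℂ}
    {Γ : Matrix (Fin (L * 2)) (Fin (L * 2)) ℝ} (h : IsGaussianWith ψ Γ) (v : Fin (L * 2) → ℝ) :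
    majoranaVec v *ᵥ ψ = -Complex.I • (majoranaVec (v ᵥ* Γ) *ᵥ ψ) := by
  rw [majoranaVec_vecMul, majoranaVec, Matrix.sum_mulVec, Matrix.sum_mulVec, Finset.smul_sum]
  refine Finset.sum_congr rfl fun μ _ => ?_
  rw [Matrix.smul_mulVec, Matrix.smul_mulVec, h.majorana_mulVec, smul_comm]

/-- The rotation property reads `γ(v) U = U γ(v O)`, which carries the annihilation relations
through `U`. -/
lemma IsGaussianWith.rotate {L : ℕ} {ψ : Bits L → ℂ}
    {Γ O : Matrix (Fin (L * 2)) (Fin (L * 2)) ℝ} {U : Matrix (Bits L) (Bits L) ℂ}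
    (h : IsGaussianWith ψ Γ) (hU : U ∈ Matrix.unitaryGroup (Bits L) ℂ)
    (hO : O ∈ Matrix.orthogonalGroup (Fin (L * 2)) ℝ) (hr : RotatesMajoranas U O) :
    IsGaussianWith (U *ᵥ ψ) (O * Γ * Oᵀ) := by
  have hU' := Matrix.mem_unitaryGroup_iff.mp hU
  have hOO : Oᵀ * O = 1 := by
    have := Matrix.mem_unitaryGroup_iff'.mp hO
    rwa [Matrix.star_eq_conjTranspose, Matrix.conjTranspose_eq_transpose_of_trivial] at this
  have h1 : ∀ μ, majorana μ * U = U * majoranaVec (O μ) := fun μ => by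
    rw [← rotatesMajoranas_iff.mp hr, ← mul_assoc, ← mul_assoc, hU', one_mul]
  have h2 : ∀ v, majoranaVec v * U = U * majoranaVec (v ᵥ* O) := fun v => by
    rw [majoranaVec_vecMul, majoranaVec, Finset.sum_mul, Finset.mul_sum]
    exact Finset.sum_congr rfl fun μ _ => by rw [smul_mul_assoc, h1, mul_smul_comm]
  refine ⟨?_, fun μ => ?_⟩
  · rw [Matrix.star_mulVec, ← Matrix.dotProduct_mulVec, Matrix.mulVec_mulVec,
      ← Matrix.star_eq_conjTranspose, Matrix.mem_unitaryGroup_iff'.mp hU, Matrix.one_mulVec,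
      h.norm_eq]
  · rw [Matrix.mulVec_mulVec, h1, ← Matrix.mulVec_mulVec, h.majoranaVec_mulVec,
      Matrix.mulVec_mulVec, h2, Matrix.mulVec_smul, Matrix.mulVec_mulVec]
    congr 4
    have e : ∀ A B : Matrix (Fin (L * 2)) (Fin (L * 2)) ℝ, (A * B) μ = A μ ᵥ* B := fun A B => rfl
    rw [← e, ← e, mul_assoc (O * Γ), hOO, mul_one]

lemma IsPureGaussian.exists_isGaussianWith {L : ℕ} {ψ : Bits L → ℂ} (h : IsPureGaussian ψ) :
    ∃ Γ, IsGaussianWith ψ Γ := by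
  obtain ⟨U, hU, O, hO, hr, rfl⟩ := h
  exact ⟨_, (isGaussianWith_vacuum L).rotate hU hO hr⟩

/-! ### Expectation values and the two-point function -/

/-- The expectation value `⟨ψ|M|ψ⟩`. -/
def expect {L : ℕ} (ψ : Bits L → ℂ) (M : Matrix (Bits L) (Bits L) ℂ) : ℂ := star ψ ⬝ᵥ (M *ᵥ ψ)

lemma trace_pureDensity_mul {L : ℕ} (ψ : Bits L → ℂ) (M : Matrix (Bits L) (Bits L) ℂ) :
    Matrix.trace (pureDensity ψ * M) = expect ψ M := by
  rw [Matrix.trace_mul_comm, pureDensity, Matrix.mul_vecMulVec, Matrix.trace_vecMulVec,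
    expect, dotProduct_comm]

lemma expect_add {L : ℕ} (ψ : Bits L → ℂ) (M N : Matrix (Bits L) (Bits L) ℂ) :
    expect ψ (M + N) = expect ψ M + expect ψ N := by
  simp [expect, Matrix.add_mulVec]

lemma expect_neg {L : ℕ} (ψ : Bits L → ℂ) (M : Matrix (Bits L) (Bits L) ℂ) :
    expect ψ (-M) = -expect ψ M := by
  simp [expect, Matrix.neg_mulVec]

lemma expect_sub {L : ℕ} (ψ : Bits L → ℂ) (M N : Matrix (Bits L) (Bits L) ℂ) :
    expect ψ (M - N) = expect ψ M - expect ψ N := by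
  simp [expect, Matrix.sub_mulVec]

lemma expect_smul {L : ℕ} (ψ : Bits L → ℂ) (c : ℂ) (M : Matrix (Bits L) (Bits L) ℂ) :
    expect ψ (c • M) = c * expect ψ M := by
  simp [expect, Matrix.smul_mulVec]

lemma expect_sum {L : ℕ} {ι : Type*} (s : Finset ι) (ψ : Bits L → ℂ)
    (M : ι → Matrix (Bits L) (Bits L) ℂ) :
    expect ψ (∑ i ∈ s, M i) = ∑ i ∈ s, expect ψ (M i) := by
  simp [expect, Matrix.sum_mulVec, dotProduct_sum]

lemma star_expect {L : ℕ} (ψ : Bits L → ℂ) (M : Matrix (Bits L) (Bits L) ℂ) :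
    star (expect ψ M) = expect ψ (star M) := by
  rw [expect, expect, Matrix.star_dotProduct, star_star, Matrix.star_mulVec,
    Matrix.dotProduct_mulVec, Matrix.star_eq_conjTranspose, dotProduct_comm]

namespace IsGaussianWith

variable {L : ℕ} {ψ : Bits L → ℂ} {Γ : Matrix (Fin (L * 2)) (Fin (L * 2)) ℝ}

/-- The two-point matrix `g` is Hermitian with `g + gᵀ = 2`, so its real part is `1`. The
annihilation relations say `g = -i g Γᵀ`: the imaginary part identifies `Im g` with `-Γᵀ`,
Hermiticity then makes `Γ` skew, and the real part gives `Γ² = -1`. -/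
lemma expect_majorana_mul (h : IsGaussianWith ψ Γ) (μ ν : Fin (L * 2)) :
    expect ψ (majorana μ * majorana ν) = (if μ = ν then 1 else 0) + Complex.I * Γ μ ν ∧
    Γ ν μ = -Γ μ ν ∧ (Γ * Γ) μ ν = if μ = ν then -1 else 0 := by
  set g : Fin (L * 2) → Fin (L * 2) → ℂ := fun μ ν => expect ψ (majorana μ * majorana ν) with hg
  have hone : expect ψ 1 = 1 := by rw [expect, Matrix.one_mulVec, h.norm_eq]
  have hsymm : ∀ μ ν, g μ ν + g ν μ = if μ = ν then 2 else 0 := fun μ ν => by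
    rw [hg, ← expect_add, majorana_add_comm]
    split_ifs
    · rw [← one_add_one_eq_two, expect_add, hone, one_add_one_eq_two]
    · simp [expect]
  have hstar : ∀ μ ν, star (g μ ν) = g ν μ := fun μ ν => by
    rw [hg, star_expect, star_mul, star_majorana, star_majorana]
  have hann : ∀ μ ν, g μ ν = -Complex.I * ∑ κ, Γ ν κ * g μ κ := fun μ ν => by
    simp only [hg]
    rw [expect, ← Matrix.mulVec_mulVec, h.majorana_mulVec, Matrix.mulVec_smul,
      Matrix.mulVec_mulVec, dotProduct_smul, smul_eq_mul]
    congr 1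
    change expect ψ _ = _
    simp only [majoranaVec, Finset.mul_sum, mul_smul_comm, expect_sum, expect_smul]
  have hre : ∀ μ ν, (g μ ν).re = if μ = ν then 1 else 0 := fun μ ν => by
    have h1 := congrArg Complex.re (hsymm μ ν)
    rw [← hstar μ ν] at h1
    split_ifs at h1 ⊢ <;> simp at h1 <;> linarith
  have him : ∀ μ ν, (g ν μ).im = -(g μ ν).im := fun μ ν => by
    rw [← hstar μ ν]
    simp
  have hI : ∀ μ ν, (g μ ν).im = -Γ ν μ := fun μ ν => by
    have := congrArg Complex.im (hann μ ν)
    simpa [hre] using this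
  have hR : ∀ μ ν, (g μ ν).re = ∑ κ, Γ ν κ * (g μ κ).im := fun μ ν => by
    have := congrArg Complex.re (hann μ ν)
    simpa using this
  have hskew : ∀ μ ν, Γ ν μ = -Γ μ ν := fun μ ν => by
    have := him μ ν
    rw [hI, hI] at this
    linarith
  refine ⟨?_, hskew μ ν, ?_⟩
  · apply Complex.ext
    · rw [show expect ψ (majorana μ * majorana ν) = g μ ν from rfl, hre]
      split_ifs <;> simp
    · rw [show expect ψ (majorana μ * majorana ν) = g μ ν from rfl, hI, hskew μ ν]
      split_ifs <;> simp
  · have := hR ν μ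
    rw [hre] at this
    simp only [hI] at this
    rw [Matrix.mul_apply]
    simp only [mul_neg, Finset.sum_neg_distrib] at this
    rw [eq_neg_iff_add_eq_zero] at this
    simp only [eq_comm (a := ν)] at this
    split_ifs at this ⊢ <;> linarith

lemma transpose_eq (h : IsGaussianWith ψ Γ) : Γᵀ = -Γ := by
  ext μ ν
  exact (h.expect_majorana_mul μ ν).2.1

lemma mul_self (h : IsGaussianWith ψ Γ) : Γ * Γ = -1 := by
  ext μ ν
  rw [(h.expect_majorana_mul μ ν).2.2, Matrix.neg_apply, Matrix.one_apply]
  split_ifs <;> simp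

lemma covariance_eq (h : IsGaussianWith ψ Γ) : covariance (pureDensity ψ) = Γ := by
  ext μ ν
  rw [covariance, Matrix.of_apply, Matrix.trace_mul_comm, trace_pureDensity_mul, expect_sub,
    (h.expect_majorana_mul μ ν).1, (h.expect_majorana_mul ν μ).1, (h.expect_majorana_mul μ ν).2.1]
  simp only [eq_comm (a := ν)]
  split_ifs <;> simp <;> ring

end IsGaussianWith

/-! ### Wick's theorem -/

/-- Moving an operator with scalar anticommutators through a product. -/
lemma mul_prod_ofFn {A : Type*} [Ring A] [Algebra ℂ A] (c : A) {N : ℕ} (g : Fin (N + 1) → A)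
    (s : Fin (N + 1) → ℂ) (h : ∀ j, c * g j + g j * c = s j • 1) :
    c * (List.ofFn g).prod = (∑ j : Fin (N + 1), ((-1) ^ (j : ℕ) * s j) •
      (List.ofFn fun i : Fin N => g (j.succAbove i)).prod) +
        (-1 : ℂ) ^ (N + 1) • ((List.ofFn g).prod * c) := by
  induction N with
  | zero => simp [← h 0]
  | succ N ih =>
    have h0 : c * g 0 = s 0 • 1 - g 0 * c := eq_sub_of_add_eq (h 0)
    rw [List.ofFn_succ, List.prod_cons, ← mul_assoc, h0, sub_mul, mul_assoc,
      ih (fun j => g j.succ) (fun j => s j.succ) fun j => h _, Fin.sum_univ_succ (n := N + 1), mul_add,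
      Finset.mul_sum, smul_mul_assoc, one_mul]
    simp only [Fin.succAbove_zero, List.ofFn_succ (n := N), Fin.succ_succAbove_zero,
      Fin.succ_succAbove_succ, List.prod_cons, Fin.val_zero, pow_zero, one_mul, Fin.val_succ,
      mul_smul_comm, pow_succ _ ((_ : Fin _) : ℕ), mul_neg_one, neg_mul, neg_smul,
      Finset.sum_neg_distrib, pow_succ _ (N + 1), mul_assoc]
    abel

lemma pfaffian_zero (A : Matrix (Fin 0) (Fin 0) ℝ) : pfaffian A = 1 := by
  simp [pfaffian]

lemma pfaffian_one (A : Matrix (Fin 1) (Fin 1) ℝ) : pfaffian A = 0 := by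
  simp [pfaffian]

lemma pfaffian_succ_succ {N : ℕ} (A : Matrix (Fin (N + 2)) (Fin (N + 2)) ℝ) :
    pfaffian A = ∑ j : Fin (N + 1), (-1) ^ (j : ℕ) * A 0 j.succ *
      pfaffian (A.submatrix (fun i => (j.succAbove i).succ) (fun i => (j.succAbove i).succ)) := by
  rw [pfaffian]

/-- The operator `γ_μ + i ∑ Γ_{μν} γ_ν`. -/
def annihilator {L : ℕ} (Γ : Matrix (Fin (L * 2)) (Fin (L * 2)) ℝ) (μ : Fin (L * 2)) :
    Matrix (Bits L) (Bits L) ℂ :=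
  majorana μ + Complex.I • majoranaVec (Γ μ)

lemma annihilator_add_comm {L : ℕ} (Γ : Matrix (Fin (L * 2)) (Fin (L * 2)) ℝ)
    (μ ν : Fin (L * 2)) :
    annihilator Γ μ * majorana ν + majorana ν * annihilator Γ μ =
      ((if μ = ν then 2 else 0) + 2 * Complex.I * Γ μ ν) • 1 := by
  have e : annihilator Γ μ * majorana ν + majorana ν * annihilator Γ μ =
      (majorana μ * majorana ν + majorana ν * majorana μ) +
      Complex.I • (majoranaVec (Γ μ) * majorana ν + majorana ν * majoranaVec (Γ μ)) := by
    simp only [annihilator, add_mul, mul_add, smul_mul_assoc, mul_smul_comm, smul_add]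
    abel
  rw [e, majorana_add_comm, majoranaVec_add_comm, add_smul, smul_smul]
  congr 1
  · split_ifs
    · rw [two_smul, one_add_one_eq_two]
    · rw [zero_smul]
  · congr 1
    ring

namespace IsGaussianWith

variable {L : ℕ} {ψ : Bits L → ℂ} {Γ : Matrix (Fin (L * 2)) (Fin (L * 2)) ℝ}

lemma annihilator_mulVec (h : IsGaussianWith ψ Γ) (μ : Fin (L * 2)) :
    annihilator Γ μ *ᵥ ψ = 0 := by
  rw [annihilator, Matrix.add_mulVec, Matrix.smul_mulVec, h.majorana_mulVec, neg_smul,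
    neg_add_cancel]

lemma expect_mul_annihilator (h : IsGaussianWith ψ Γ) (μ : Fin (L * 2))
    (M : Matrix (Bits L) (Bits L) ℂ) : expect ψ (M * annihilator Γ μ) = 0 := by
  rw [expect, ← Matrix.mulVec_mulVec, h.annihilator_mulVec, Matrix.mulVec_zero, dotProduct_zero]

/-- `γ_μ` is half the sum of the annihilator and its adjoint, and the adjoint vanishes against the
bra `⟨ψ|`. -/
lemma expect_majorana_mul_eq (h : IsGaussianWith ψ Γ) (μ : Fin (L * 2))
    (M : Matrix (Bits L) (Bits L) ℂ) :
    expect ψ (majorana μ * M) = 2⁻¹ * expect ψ (annihilator Γ μ * M) := by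
  have h0 : expect ψ (star (annihilator Γ μ) * M) = 0 := by
    have := h.expect_mul_annihilator μ (star M)
    rw [← star_star (star M * annihilator Γ μ), ← star_expect, star_mul, star_star] at this
    exact star_eq_zero.mp this
  have e : majorana μ * M = (2⁻¹ : ℂ) • (annihilator Γ μ * M + star (annihilator Γ μ) * M) := by
    rw [← add_mul, ← smul_mul_assoc]
    congr 1
    have : star (Complex.I • majoranaVec (Γ μ)) = -(Complex.I • majoranaVec (Γ μ)) := by
      rw [star_smul, star_majoranaVec, ← neg_smul]
      congr 1
      exact Complex.conj_I
    rw [annihilator, star_add, star_majorana, this, add_add_add_comm, add_neg_cancel, add_zero,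
      ← two_smul ℂ, smul_smul]
    norm_num
  rw [e, expect_smul, expect_add, h0, add_zero]

/-- Wick's theorem, in the presence of a spectator operator. -/
theorem expect_prod_mul (h : IsGaussianWith ψ Γ) {N : ℕ} (f : Fin N → Fin (L * 2))
    (hf : Function.Injective f) (R : Matrix (Bits L) (Bits L) ℂ)
    (hR : ∀ i, ∃ ε : ℂ, annihilator Γ (f i) * R = ε • (R * annihilator Γ (f i))) :
    expect ψ ((List.ofFn fun i => majorana (f i)).prod * R) =
      Complex.I ^ (N / 2) * pfaffian (Γ.submatrix f f) * expect ψ R := by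
  have hvan : ∀ (μ) (M : Matrix (Bits L) (Bits L) ℂ),
      (∃ ε : ℂ, annihilator Γ μ * R = ε • (R * annihilator Γ μ)) →
        expect ψ (M * annihilator Γ μ * R) = 0 := by
    rintro μ M ⟨ε, hε⟩
    rw [mul_assoc, hε, mul_smul_comm, ← mul_assoc, expect_smul, h.expect_mul_annihilator, mul_zero]
  induction N using Nat.twoStepInduction with
  | zero => simp [pfaffian_zero]
  | one =>
    have := hvan (f 0) 1 (hR 0)
    rw [one_mul] at this
    simp [pfaffian_one, h.expect_majorana_mul_eq, this]
  | more N ih _ =>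
    -- Half the annihilator replaces the first Majorana operator and is moved to the right. Its
    -- scalar anticommutators `2iΓ` produce the first-row expansion of the Pfaffian; once past the
    -- product it also passes `R`, up to a scalar, and kills `ψ`.
    rw [List.ofFn_succ, List.prod_cons, mul_assoc, h.expect_majorana_mul_eq, ← mul_assoc,
      mul_prod_ofFn _ _ _ fun j => annihilator_add_comm Γ (f 0) (f j.succ), add_mul, expect_add,
      smul_mul_assoc, expect_smul, hvan _ _ (hR 0), mul_zero, add_zero, Finset.sum_mul, expect_sum,
      pfaffian_succ_succ]
    push_cast
    rw [Finset.mul_sum, Finset.mul_sum, Finset.sum_mul]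
    refine Finset.sum_congr rfl fun j _ => ?_
    have hne : f 0 ≠ f j.succ := fun e => Fin.succ_ne_zero j (hf e).symm
    have := ih (fun i => f (j.succAbove i).succ)
      (fun a b e => Fin.succAbove_right_injective (Fin.succ_injective _ (hf e))) fun i => hR _
    rw [smul_mul_assoc, expect_smul, this, if_neg hne, Matrix.submatrix_submatrix,
      Nat.add_div_right _ two_pos, pow_succ]
    simp only [Matrix.submatrix_apply, Function.comp_def]
    ring

/-! ### Expectation values of Majorana strings -/

/-- The enumeration need not be increasing, so explicitly listed blocks can be evaluated without
sorting them. -/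
lemma norm_expect_image (h : IsGaussianWith ψ Γ) {N : ℕ} (f : Fin N → Fin (L * 2))
    (hf : Function.Injective f) :
    ‖expect ψ (majoranaString (Finset.univ.image f))‖ = |pfaffian (Γ.submatrix f f)| := by
  have hone : expect ψ 1 = 1 := by rw [expect, Matrix.one_mulVec, h.norm_eq]
  have e := h.expect_prod_mul f hf 1 fun i => ⟨1, by simp⟩
  have hX : Finset.univ.image f = (List.ofFn f).toFinset := by
    ext x
    simp
  rw [hX]
  have : (List.ofFn fun i => majorana (f i)) = (List.ofFn f).map majorana := by
    simp [List.map_ofFn, Function.comp_def]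
  rw [this, mul_one, hone, mul_one] at e
  rcases majoranaString_eq_or_neg (List.ofFn f) (List.nodup_ofFn.mpr hf) with h' | h' <;>
    rw [h'] <;> simp only [expect_neg, norm_neg, e] <;> simp

lemma norm_expect_majoranaString (h : IsGaussianWith ψ Γ) (X : Finset (Fin (L * 2))) {k : ℕ}
    (hk : X.card = k) :
    ‖expect ψ (majoranaString X)‖ =
      |pfaffian (Γ.submatrix (X.orderEmbOfFin hk) (X.orderEmbOfFin hk))| := by
  rw [← h.norm_expect_image _ (X.orderEmbOfFin hk).injective]
  congr 3
  simp

lemma stringMoment_eq (h : IsGaussianWith ψ Γ) (α : ℝ) :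
    stringMoment α (pureDensity ψ) = pfaffianMoment α Γ := by
  refine Finset.sum_congr rfl fun X _ => ?_
  rw [trace_pureDensity_mul, h.norm_expect_majoranaString X rfl]

/-- Wick's theorem with spectator `γ_T`: for `x ∈ S` the annihilator of `x` anticommutes with each
`γ_y`, `y ∈ T`, because `x ≠ y` and `Γ x y = 0`. -/
lemma norm_expect_union (h : IsGaussianWith ψ Γ) {S T : Finset (Fin (L * 2))}
    (hST : Disjoint S T) (h0 : ∀ x ∈ S, ∀ y ∈ T, Γ x y = 0) :
    ‖expect ψ (majoranaString (S ∪ T))‖ =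
      ‖expect ψ (majoranaString S)‖ * ‖expect ψ (majoranaString T)‖ := by
  set f := S.orderEmbOfFin rfl with hf
  have hfS : ∀ i, f i ∈ S := fun i => Finset.orderEmbOfFin_mem S rfl i
  have e := h.expect_prod_mul f f.injective (majoranaString T) fun i => by
    have : ∀ l : List (Fin (L * 2)), (∀ y ∈ l, y ∈ T) → ∃ ε : ℂ,
        annihilator Γ (f i) * (l.map majorana).prod =
          ε • ((l.map majorana).prod * annihilator Γ (f i)) := by
      intro l hl
      induction l with
      | nil => exact ⟨1, by simp⟩
      | cons y l ih =>
        obtain ⟨ε, hε⟩ := ih fun z hz => hl z (List.mem_cons_of_mem _ hz)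
        have hy := hl y List.mem_cons_self
        have := annihilator_add_comm Γ (f i) y
        rw [h0 _ (hfS i) y hy, if_neg (ne_of_mem_of_not_mem hy (Finset.disjoint_left.mp hST (hfS i))).symm,
          Complex.ofReal_zero, mul_zero, add_zero, zero_smul] at this
        refine ⟨-ε, ?_⟩
        rw [List.map_cons, List.prod_cons, ← mul_assoc, eq_neg_of_add_eq_zero_left this, neg_mul,
          mul_assoc, hε, mul_smul_comm, mul_assoc, neg_smul]
    exact this _ fun y hy => (Finset.mem_sort _).mp hy
  have hl : (List.ofFn f ++ T.sort (· ≤ ·)).Nodup := by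
    refine List.Nodup.append (List.nodup_ofFn.mpr f.injective) (Finset.sort_nodup _ _) ?_
    intro x hx hx'
    obtain ⟨i, rfl⟩ := List.mem_ofFn.mp hx
    exact Finset.disjoint_left.mp hST (hfS i) ((Finset.mem_sort _).mp hx')
  have hX : S ∪ T = (List.ofFn f ++ T.sort (· ≤ ·)).toFinset := by
    ext x
    rw [List.toFinset_append, Finset.mem_union, Finset.mem_union, Finset.sort_toFinset]
    refine or_congr_left ?_
    rw [List.mem_toFinset, List.mem_ofFn, ← Set.mem_range, hf, Finset.range_orderEmbOfFin,
      Finset.mem_coe]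
  have hprod : ((List.ofFn f ++ T.sort (· ≤ ·)).map majorana).prod =
      (List.ofFn fun i => majorana (f i)).prod * majoranaString T := by
    rw [List.map_append, List.prod_append, List.map_ofFn]
    rfl
  have hn : ‖expect ψ (majoranaString (S ∪ T))‖ =
      ‖expect ψ ((List.ofFn fun i => majorana (f i)).prod * majoranaString T)‖ := by
    rw [hX]
    rcases majoranaString_eq_or_neg _ hl with h' | h' <;> rw [h', hprod]
    rw [expect_neg, norm_neg]
  rw [hn, e, norm_mul, norm_mul, norm_pow, Complex.norm_I, one_pow, one_mul, Complex.norm_real,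
    h.norm_expect_majoranaString S rfl, Real.norm_eq_abs]

end IsGaussianWith

/-! ### Principal minors -/

/-- Direct expansion is enough: a mode of the canonical form involves at most four Majorana indices,
and larger minors factor. -/
lemma pfaffian_sq_eq_det {N : ℕ} (hN : N ≤ 4) (A : Matrix (Fin N) (Fin N) ℝ) (hA : Aᵀ = -A) :
    pfaffian A ^ 2 = A.det := by
  have h : ∀ i j, A j i = -A i j := fun i j => congrFun (congrFun hA i) j
  have hd : ∀ i, A i i = 0 := fun i => by linarith [h i i]
  interval_cases N
  · simp [pfaffian_zero]
  · simp [pfaffian_one, hd]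
  · simp [pfaffian_succ_succ, pfaffian_zero, Matrix.det_fin_two, hd, h 0 1]
    ring
  · simp [pfaffian_succ_succ, pfaffian_one, Matrix.det_fin_three, hd, h 0 1, h 0 2, h 1 2]
    ring
  · simp [pfaffian_succ_succ, pfaffian_zero, Matrix.det_succ_row_zero (n := 3),
      Matrix.det_fin_three, Fin.sum_univ_succ, hd, h 0 1, h 0 2, h 1 2, h 0 3, h 1 3, h 2 3,
      Fin.succAbove]
    ring

/-- The principal minor of `Γ` on the index set `X`. -/
def principalMinor {ι : Type*} [DecidableEq ι] (Γ : Matrix ι ι ℝ) (X : Finset ι) : ℝ :=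
  (Γ.submatrix (fun x : X => (x : ι)) (fun x : X => (x : ι))).det

/-- With `S` listed before `T` the submatrix is block triangular. -/
lemma principalMinor_union {ι : Type*} [DecidableEq ι] (Γ : Matrix ι ι ℝ) {S T : Finset ι}
    (hST : Disjoint S T) (h0 : ∀ x ∈ S, ∀ y ∈ T, Γ x y = 0) :
    principalMinor Γ (S ∪ T) = principalMinor Γ S * principalMinor Γ T := by
  rw [principalMinor, ← Matrix.det_submatrix_equiv_self (Equiv.Finset.union S T hST),
    principalMinor, principalMinor, ← Matrix.det_fromBlocks_zero₁₂ _
      (Γ.submatrix (fun x : T => (x : ι)) (fun x : S => (x : ι)))]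
  congr 1
  ext i j
  rcases i with i | i <;> rcases j with j | j <;> simp [h0]

lemma principalMinor_eq_det_orderEmb {N : ℕ} (Γ : Matrix (Fin N) (Fin N) ℝ) (X : Finset (Fin N))
    {k : ℕ} (hk : X.card = k) :
    principalMinor Γ X = (Γ.submatrix (X.orderEmbOfFin hk) (X.orderEmbOfFin hk)).det := by
  rw [principalMinor, ← Matrix.det_submatrix_equiv_self (X.orderIsoOfFin hk).toEquiv]
  rfl

namespace IsGaussianWith

variable {L : ℕ} {ψ : Bits L → ℂ} {Γ : Matrix (Fin (L * 2)) (Fin (L * 2)) ℝ}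

lemma norm_expect_sq_of_card_le (h : IsGaussianWith ψ Γ) (X : Finset (Fin (L * 2)))
    (hX : X.card ≤ 4) : ‖expect ψ (majoranaString X)‖ ^ 2 = principalMinor Γ X := by
  rw [h.norm_expect_majoranaString X rfl, sq_abs, principalMinor_eq_det_orderEmb Γ X rfl]
  refine pfaffian_sq_eq_det hX _ ?_
  rw [Matrix.transpose_submatrix, h.transpose_eq]
  rfl

/-- `|⟨γ_X⟩|² = det Γ_X` for a covariance matrix with small blocks. -/
lemma norm_expect_sq (h : IsGaussianWith ψ Γ) {κ : Type*} [DecidableEq κ] [Fintype κ]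
    (mode : Fin (L * 2) → κ)
    (h0 : ∀ x y, mode x ≠ mode y → Γ x y = 0)
    (hcard : ∀ k, (Finset.univ.filter fun x => mode x = k).card ≤ 4) (X : Finset (Fin (L * 2))) :
    ‖expect ψ (majoranaString X)‖ ^ 2 = principalMinor Γ X := by
  suffices ∀ (K : Finset κ) (X : Finset (Fin (L * 2))), (∀ x ∈ X, mode x ∈ K) →
      ‖expect ψ (majoranaString X)‖ ^ 2 = principalMinor Γ X from
    this Finset.univ X fun x _ => Finset.mem_univ _
  -- Both sides are multiplicative over uncoupled sets, so the modes met by `X` are removed one at a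
  -- time.
  intro K
  induction K using Finset.induction_on with
  | empty =>
    intro X hX
    refine h.norm_expect_sq_of_card_le X ?_
    rw [Finset.eq_empty_of_forall_notMem (s := X) fun x hx => by simpa using hX x hx]
    simp
  | insert k K hk ih =>
    intro X hX
    have hdis : Disjoint (X.filter fun x => mode x = k) (X.filter fun x => ¬ mode x = k) :=
      Finset.disjoint_filter_filter_not _ _ _
    have hdec : ∀ x ∈ X.filter fun x => mode x = k, ∀ y ∈ X.filter fun x => ¬ mode x = k,
        Γ x y = 0 := fun x hx y hy => by
      refine h0 x y fun e => (Finset.mem_filter.mp hy).2 ?_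
      rw [← e, (Finset.mem_filter.mp hx).2]
    rw [← Finset.filter_union_filter_not_eq (fun x => mode x = k) X, h.norm_expect_union hdis hdec,
      principalMinor_union Γ hdis hdec, mul_pow, ih (X.filter fun x => ¬ mode x = k),
      h.norm_expect_sq_of_card_le (X.filter fun x => mode x = k)]
    · exact (Finset.card_le_card (Finset.filter_subset_filter _ (Finset.subset_univ _))).trans
        (hcard k)
    · intro x hx
      obtain ⟨hx, hne⟩ := Finset.mem_filter.mp hx
      exact (Finset.mem_insert.mp (hX x hx)).resolve_left hne

end IsGaussianWith

/-! ### Factorization of sums over Majorana strings -/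

lemma sum_powerset_union {ι : Type*} [DecidableEq ι] {A B : Finset ι} (hAB : Disjoint A B)
    (f : Finset ι → ℝ) :
    ∑ X ∈ (A ∪ B).powerset, f X = ∑ S ∈ A.powerset, ∑ T ∈ B.powerset, f (S ∪ T) := by
  rw [← Finset.sum_product']
  refine Finset.sum_nbij' (fun X => (X ∩ A, X ∩ B)) (fun p => p.1 ∪ p.2) ?_ ?_ ?_ ?_ ?_
  · intro X _
    simp
  · intro p hp
    simp only [Finset.mem_product, Finset.mem_powerset] at hp ⊢
    exact Finset.union_subset_union hp.1 hp.2
  · intro X hX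
    rw [← Finset.inter_union_distrib_left, Finset.inter_eq_left.mpr (Finset.mem_powerset.mp hX)]
  · rintro ⟨S, T⟩ hp
    simp only [Finset.mem_product, Finset.mem_powerset] at hp
    have h1 : T ∩ A = ∅ := Finset.disjoint_iff_inter_eq_empty.mp
      (Finset.disjoint_of_subset_left hp.2 hAB.symm)
    have h2 : S ∩ B = ∅ := Finset.disjoint_iff_inter_eq_empty.mp
      (Finset.disjoint_of_subset_left hp.1 hAB)
    simp [Finset.union_inter_distrib_right, h1, h2, Finset.inter_eq_left.mpr hp.1,
      Finset.inter_eq_left.mpr hp.2]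
  · intro X hX
    rw [← Finset.inter_union_distrib_left, Finset.inter_eq_left.mpr (Finset.mem_powerset.mp hX)]

/-- A set `X` is a free choice of one subset per mode, and expectations factor over modes, so the
distributive law applies. -/
lemma IsGaussianWith.sum_norm_expect_rpow {L : ℕ} {ψ : Bits L → ℂ}
    {Γ : Matrix (Fin (L * 2)) (Fin (L * 2)) ℝ} (h : IsGaussianWith ψ Γ) {κ : Type*} [DecidableEq κ]
    [Fintype κ] (mode : Fin (L * 2) → κ) (h0 : ∀ x y, mode x ≠ mode y → Γ x y = 0) (p : ℝ) :
    ∑ X : Finset (Fin (L * 2)), ‖expect ψ (majoranaString X)‖ ^ p =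
      ∏ k, ∑ S ∈ (Finset.univ.filter fun x => mode x = k).powerset,
        ‖expect ψ (majoranaString S)‖ ^ p := by
  have key : ∀ K : Finset κ, ∑ X ∈ (Finset.univ.filter fun x => mode x ∈ K).powerset,
      ‖expect ψ (majoranaString X)‖ ^ p =
      ∏ k ∈ K, ∑ S ∈ (Finset.univ.filter fun x => mode x = k).powerset,
        ‖expect ψ (majoranaString S)‖ ^ p := by
    intro K
    induction K using Finset.induction_on with
    | empty =>
      have : expect ψ (majoranaString ∅) = 1 := by
        rw [majoranaString, Finset.sort_empty, List.map_nil, List.prod_nil, expect,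
          Matrix.one_mulVec, h.norm_eq]
      simp [this]
    | insert k K hk ih =>
      have hu : (Finset.univ.filter fun x => mode x ∈ insert k K) =
          (Finset.univ.filter fun x => mode x = k) ∪ (Finset.univ.filter fun x => mode x ∈ K) := by
        ext x
        simp
      have hd : ∀ x y, mode x = k → mode y ∈ K → mode x ≠ mode y := fun x y hx hy e =>
        hk (hx ▸ e ▸ hy)
      have hdis : Disjoint (Finset.univ.filter fun x => mode x = k)
          (Finset.univ.filter fun x => mode x ∈ K) := by
        rw [Finset.disjoint_left]
        intro x hx hx'
        exact hd x x (by simpa using hx) (by simpa using hx') rfl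
      rw [hu, sum_powerset_union hdis, Finset.prod_insert hk, ← ih, Finset.sum_mul_sum]
      refine Finset.sum_congr rfl fun S hS => Finset.sum_congr rfl fun T hT => ?_
      rw [Finset.mem_powerset] at hS hT
      rw [h.norm_expect_union (Finset.disjoint_of_subset_left hS
        (Finset.disjoint_of_subset_right hT hdis)), Real.mul_rpow (norm_nonneg _) (norm_nonneg _)]
      intro x hx y hy
      exact h0 x y (hd x y (by simpa using hS hx) (by simpa using hT hy))
  rw [← key Finset.univ]
  simp

/-! ### Entries of the canonical form -/

/-- The Majorana index of type `a` of the `k`-th mode of `A`. -/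
def indexA {m : ℕ} (n : ℕ) (k : Fin m) (a : Fin 2) : Fin ((m + n) * 2) :=
  splitIndex m n (Sum.inl (finProdFinEquiv (k, a)))

/-- The Majorana index of type `a` of the `k`-th mode of `B`. -/
def indexB (m : ℕ) {n : ℕ} (k : Fin n) (a : Fin 2) : Fin ((m + n) * 2) :=
  splitIndex m n (Sum.inr (finProdFinEquiv (k, a)))

lemma index_cases {m n : ℕ} (x : Fin ((m + n) * 2)) :
    (∃ k a, x = indexA n k a) ∨ ∃ k a, x = indexB m k a := by
  obtain ⟨y, rfl⟩ := (splitIndex m n).surjective x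
  rcases y with i | j
  · obtain ⟨⟨k, a⟩, rfl⟩ := finProdFinEquiv.surjective i
    exact Or.inl ⟨k, a, rfl⟩
  · obtain ⟨⟨k, a⟩, rfl⟩ := finProdFinEquiv.surjective j
    exact Or.inr ⟨k, a, rfl⟩

lemma indexA_inj {m n : ℕ} {k l : Fin m} {a b : Fin 2} :
    indexA n k a = indexA n l b ↔ k = l ∧ a = b := by
  simp [indexA]

lemma indexB_inj {m n : ℕ} {k l : Fin n} {a b : Fin 2} :
    indexB m k a = indexB m l b ↔ k = l ∧ a = b := by
  simp [indexB]

lemma indexA_ne_indexB {m n : ℕ} {k : Fin m} {l : Fin n} {a b : Fin 2} :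
    indexA n k a ≠ indexB m l b := by
  simp [indexA, indexB]

section entries

variable {m n : ℕ} (ν : Fin (min m n) → ℝ)

lemma canonicalCov_AA (k l : Fin m) (a b : Fin 2) :
    canonicalCov m n ν (indexA n k a) (indexA n l b) =
      if k = l then padOne ν k * matJ a b else 0 := by
  simp [canonicalCov, indexA, canDiag, Matrix.diagonal_apply]

lemma canonicalCov_AB (k : Fin m) (l : Fin n) (a b : Fin 2) :
    canonicalCov m n ν (indexA n k a) (indexB m l b) =
      if (k : ℕ) = l then √(1 - padOne ν k ^ 2) * matZ a b else 0 := by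
  simp [canonicalCov, indexA, indexB, canOff]

lemma canonicalCov_BA (k : Fin n) (l : Fin m) (a b : Fin 2) :
    canonicalCov m n ν (indexB m k a) (indexA n l b) =
      -if (l : ℕ) = k then √(1 - padOne ν l ^ 2) * matZ b a else 0 := by
  simp [canonicalCov, indexA, indexB, canOff]

lemma canonicalCov_BB (k l : Fin n) (a b : Fin 2) :
    canonicalCov m n ν (indexB m k a) (indexB m l b) =
      if k = l then padOne ν k * matJ a b else 0 := by
  simp [canonicalCov, indexB, canDiag, Matrix.diagonal_apply]

end entries

/-- The mode to which a Majorana index belongs in the canonical form. -/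
def modeOf {m n : ℕ} (x : Fin ((m + n) * 2)) : Fin (max m n) :=
  Sum.elim (fun i => Fin.castLE (le_max_left m n) i.divNat)
    (fun j => Fin.castLE (le_max_right m n) j.divNat) ((splitIndex m n).symm x)

lemma divNat_finProdFinEquiv {m : ℕ} (k : Fin m) (a : Fin 2) :
    (finProdFinEquiv (k, a)).divNat = k :=
  congrArg Prod.fst (finProdFinEquiv.symm_apply_apply (k, a))

lemma modeOf_indexA {m n : ℕ} (k : Fin m) (a : Fin 2) :
    modeOf (indexA n k a) = Fin.castLE (le_max_left m n) k := by
  simp only [modeOf, indexA, Equiv.symm_apply_apply, Sum.elim_inl, divNat_finProdFinEquiv]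

lemma modeOf_indexB {m n : ℕ} (k : Fin n) (a : Fin 2) :
    modeOf (indexB m k a) = Fin.castLE (le_max_right m n) k := by
  simp only [modeOf, indexB, Equiv.symm_apply_apply, Sum.elim_inr, divNat_finProdFinEquiv]

lemma canonicalCov_eq_zero {m n : ℕ} (ν : Fin (min m n) → ℝ) (x y : Fin ((m + n) * 2))
    (h : modeOf x ≠ modeOf y) : canonicalCov m n ν x y = 0 := by
  rcases index_cases x with ⟨k, a, rfl⟩ | ⟨k, a, rfl⟩ <;>
  rcases index_cases y with ⟨l, b, rfl⟩ | ⟨l, b, rfl⟩ <;>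
  simp only [modeOf_indexA, modeOf_indexB, ne_eq, Fin.ext_iff, Fin.val_castLE] at h <;>
  simp [canonicalCov_AA, canonicalCov_AB, canonicalCov_BA, canonicalCov_BB, Fin.ext_iff, h,
    Ne.symm h]

lemma filter_modeOf_both {m n : ℕ} (k : Fin (max m n)) (hm : (k : ℕ) < m) (hn : (k : ℕ) < n) :
    (Finset.univ.filter fun x : Fin ((m + n) * 2) => modeOf x = k) =
      {indexA n ⟨k, hm⟩ 0, indexA n ⟨k, hm⟩ 1, indexB m ⟨k, hn⟩ 0, indexB m ⟨k, hn⟩ 1} := by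
  ext x
  simp only [Finset.mem_filter, Finset.mem_univ, true_and, Finset.mem_insert,
    Finset.mem_singleton]
  rcases index_cases x with ⟨l, b, rfl⟩ | ⟨l, b, rfl⟩
  · simp only [modeOf_indexA, indexA_inj, indexA_ne_indexB, or_false]
    simp only [Fin.ext_iff, Fin.val_castLE, Fin.val_zero, Fin.val_one]
    omega
  · simp only [modeOf_indexB, indexB_inj, indexA_ne_indexB.symm, false_or]
    simp only [Fin.ext_iff, Fin.val_castLE, Fin.val_zero, Fin.val_one]
    omega

lemma filter_modeOf_left {m n : ℕ} (k : Fin (max m n)) (hm : (k : ℕ) < m) (hn : ¬ (k : ℕ) < n) :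
    (Finset.univ.filter fun x : Fin ((m + n) * 2) => modeOf x = k) =
      {indexA n ⟨k, hm⟩ 0, indexA n ⟨k, hm⟩ 1} := by
  ext x
  simp only [Finset.mem_filter, Finset.mem_univ, true_and, Finset.mem_insert,
    Finset.mem_singleton]
  rcases index_cases x with ⟨l, b, rfl⟩ | ⟨l, b, rfl⟩
  · simp only [modeOf_indexA, indexA_inj]
    simp only [Fin.ext_iff, Fin.val_castLE, Fin.val_zero, Fin.val_one]
    omega
  · simp only [modeOf_indexB, indexA_ne_indexB.symm, or_self, iff_false]
    simp only [Fin.ext_iff, Fin.val_castLE]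
    omega

lemma filter_modeOf_right {m n : ℕ} (k : Fin (max m n)) (hm : ¬ (k : ℕ) < m) (hn : (k : ℕ) < n) :
    (Finset.univ.filter fun x : Fin ((m + n) * 2) => modeOf x = k) =
      {indexB m ⟨k, hn⟩ 0, indexB m ⟨k, hn⟩ 1} := by
  ext x
  simp only [Finset.mem_filter, Finset.mem_univ, true_and, Finset.mem_insert,
    Finset.mem_singleton]
  rcases index_cases x with ⟨l, b, rfl⟩ | ⟨l, b, rfl⟩
  · simp only [modeOf_indexA, indexA_ne_indexB, or_self, iff_false]
    simp only [Fin.ext_iff, Fin.val_castLE]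
    omega
  · simp only [modeOf_indexB, indexB_inj]
    simp only [Fin.ext_iff, Fin.val_castLE, Fin.val_zero, Fin.val_one]
    omega

lemma mode_cases {m n : ℕ} (k : Fin (max m n)) : ((k : ℕ) < m ∧ (k : ℕ) < n) ∨
    ((k : ℕ) < m ∧ ¬ (k : ℕ) < n) ∨ (¬ (k : ℕ) < m ∧ (k : ℕ) < n) := by
  have := k.isLt
  rw [lt_max_iff] at this
  tauto

lemma card_filter_modeOf_le {m n : ℕ} (k : Fin (max m n)) :
    (Finset.univ.filter fun x : Fin ((m + n) * 2) => modeOf x = k).card ≤ 4 := by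
  rcases mode_cases k with ⟨hm, hn⟩ | ⟨hm, hn⟩ | ⟨hm, hn⟩
  · rw [filter_modeOf_both k hm hn]
    exact Finset.card_le_four
  · rw [filter_modeOf_left k hm hn]
    exact Finset.card_le_two.trans (by norm_num)
  · rw [filter_modeOf_right k hm hn]
    exact Finset.card_le_two.trans (by norm_num)

/-! ### Moments of the canonical form -/

lemma pfaffian_two (A : Matrix (Fin 2) (Fin 2) ℝ) : pfaffian A = A 0 1 := by
  simp [pfaffian_succ_succ, pfaffian_zero]

lemma pfaffian_three (A : Matrix (Fin 3) (Fin 3) ℝ) : pfaffian A = 0 := by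
  simp [pfaffian_succ_succ, pfaffian_one]

lemma pfaffian_four (A : Matrix (Fin 4) (Fin 4) ℝ) :
    pfaffian A = A 0 1 * A 2 3 - A 0 2 * A 1 3 + A 0 3 * A 1 2 := by
  simp [pfaffian_succ_succ, pfaffian_zero, Fin.sum_univ_succ, Fin.succAbove]
  ring

lemma sum_powerset_pair_eq {ι : Type*} [DecidableEq ι] {x y : ι} (hxy : x ≠ y)
    (f : Finset ι → ℝ) :
    ∑ S ∈ ({x, y} : Finset ι).powerset, f S = f ∅ + f {y} + (f {x} + f {x, y}) := by
  rw [Finset.sum_powerset_insert (a := x) (by simpa using hxy), ← insert_empty_eq y,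
    Finset.sum_powerset_insert (Finset.notMem_empty _),
    Finset.sum_powerset_insert (Finset.notMem_empty _)]
  simp

namespace IsGaussianWith

section blocks

variable {L : ℕ} {ψ : Bits L → ℂ} {Γ : Matrix (Fin (L * 2)) (Fin (L * 2)) ℝ}

lemma norm_expect_empty (h : IsGaussianWith ψ Γ) : ‖expect ψ (majoranaString ∅)‖ = 1 := by
  simpa [pfaffian_zero] using h.norm_expect_image (N := 0) Fin.elim0 (fun i => i.elim0)

lemma norm_expect_singleton (h : IsGaussianWith ψ Γ) (x : Fin (L * 2)) :
    ‖expect ψ (majoranaString {x})‖ = 0 := by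
  have := h.norm_expect_image (N := 1) ![x] (Function.injective_of_subsingleton _)
  rw [pfaffian_one, abs_zero] at this
  rw [← this]
  simp

lemma norm_expect_pair (h : IsGaussianWith ψ Γ) {x y : Fin (L * 2)} (hxy : x ≠ y) :
    ‖expect ψ (majoranaString {x, y})‖ = |Γ x y| := by
  have := h.norm_expect_image (N := 2) ![x, y] (by
    rw [Function.Injective]
    simp [Fin.forall_fin_two, hxy, hxy.symm])
  rw [pfaffian_two] at this
  simpa [Fin.univ_succ] using this

lemma norm_expect_triple (h : IsGaussianWith ψ Γ) {x y z : Fin (L * 2)} (hxy : x ≠ y)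
    (hxz : x ≠ z) (hyz : y ≠ z) : ‖expect ψ (majoranaString {x, y, z})‖ = 0 := by
  have := h.norm_expect_image (N := 3) ![x, y, z] (by
    rw [Function.Injective]
    simp [Fin.forall_fin_succ, hxy, hxy.symm, hxz, hxz.symm, hyz, hyz.symm])
  rw [pfaffian_three, abs_zero] at this
  rw [← this]
  simp [Fin.univ_succ]

lemma norm_expect_quadruple (h : IsGaussianWith ψ Γ) {x y z w : Fin (L * 2)} (hxy : x ≠ y)
    (hxz : x ≠ z) (hxw : x ≠ w) (hyz : y ≠ z) (hyw : y ≠ w) (hzw : z ≠ w) :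
    ‖expect ψ (majoranaString {x, y, z, w})‖ = |Γ x y * Γ z w - Γ x z * Γ y w + Γ x w * Γ y z| := by
  have := h.norm_expect_image (N := 4) ![x, y, z, w] (by
    rw [Function.Injective]
    simp [Fin.forall_fin_succ, hxy, hxy.symm, hxz, hxz.symm, hyz, hyz.symm, hxw, hxw.symm, hyw,
      hyw.symm, hzw, hzw.symm])
  rw [pfaffian_four] at this
  simpa [Fin.univ_succ] using this

lemma sum_powerset_pair (h : IsGaussianWith ψ Γ) {x y : Fin (L * 2)} (hxy : x ≠ y) {p : ℝ}
    (hp : p ≠ 0) :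
    ∑ S ∈ ({x, y} : Finset (Fin (L * 2))).powerset, ‖expect ψ (majoranaString S)‖ ^ p =
      1 + |Γ x y| ^ p := by
  rw [sum_powerset_pair_eq hxy]
  simp [h.norm_expect_empty, h.norm_expect_singleton, h.norm_expect_pair hxy, Real.zero_rpow hp]

lemma sum_powerset_quadruple (h : IsGaussianWith ψ Γ) {x y z w : Fin (L * 2)} (hxy : x ≠ y)
    (hxz : x ≠ z) (hxw : x ≠ w) (hyz : y ≠ z) (hyw : y ≠ w) (hzw : z ≠ w) {p : ℝ} (hp : p ≠ 0) :
    ∑ S ∈ ({x, y, z, w} : Finset (Fin (L * 2))).powerset, ‖expect ψ (majoranaString S)‖ ^ p =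
      1 + |Γ x y| ^ p + |Γ x z| ^ p + |Γ x w| ^ p + |Γ y z| ^ p + |Γ y w| ^ p + |Γ z w| ^ p +
        |Γ x y * Γ z w - Γ x z * Γ y w + Γ x w * Γ y z| ^ p := by
  rw [Finset.sum_powerset_insert (a := x) (by simp [hxy, hxz, hxw]),
    Finset.sum_powerset_insert (a := y) (by simp [hyz, hyw]),
    Finset.sum_powerset_insert (a := y) (by simp [hyz, hyw])]
  simp only [sum_powerset_pair_eq hzw, insert_empty_eq]
  rw [h.norm_expect_quadruple hxy hxz hxw hyz hyw hzw, h.norm_expect_triple hxy hxz hyz,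
    h.norm_expect_triple hxy hxw hyw, h.norm_expect_triple hxz hxw hzw,
    h.norm_expect_triple hyz hyw hzw, h.norm_expect_pair hxy, h.norm_expect_pair hxz,
    h.norm_expect_pair hxw, h.norm_expect_pair hyz, h.norm_expect_pair hyw, h.norm_expect_pair hzw,
    h.norm_expect_empty]
  simp only [h.norm_expect_singleton, Real.zero_rpow hp, Real.one_rpow]
  ring

end blocks

section canonical

variable {m n : ℕ} {ψ : Bits (m + n) → ℂ} {ν : Fin (min m n) → ℝ}

lemma norm_expect_sq_canonical (h : IsGaussianWith ψ (canonicalCov m n ν))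
    (X : Finset (Fin ((m + n) * 2))) :
    ‖expect ψ (majoranaString X)‖ ^ 2 = principalMinor (canonicalCov m n ν) X :=
  h.norm_expect_sq modeOf (canonicalCov_eq_zero ν) card_filter_modeOf_le X

/-- In a joined block the empty set gives `1`, the pairs give `ν, ν, μ, μ, 0, 0` in absolute value,
odd sets give `0`, and the full set gives `ν² + μ² = 1`. An unpaired mode gives `1 + 1`. The
exponent must be nonzero for the vanishing terms to drop out. -/
lemma sum_mode (h : IsGaussianWith ψ (canonicalCov m n ν)) (hν0 : ∀ k, 0 ≤ ν k)
    (hν1 : ∀ k, ν k ≤ 1)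
    {p : ℝ} (hp : p ≠ 0) (k : Fin (max m n)) :
    ∑ S ∈ (Finset.univ.filter fun x => modeOf x = k).powerset,
      ‖expect ψ (majoranaString S)‖ ^ p =
      if hk : (k : ℕ) < min m n then
        2 * (1 + ν ⟨k, hk⟩ ^ p + √(1 - ν ⟨k, hk⟩ ^ 2) ^ p) else 2 := by
  rcases mode_cases k with ⟨hm, hn⟩ | ⟨hm, hn⟩ | ⟨hm, hn⟩
  · have hk : (k : ℕ) < min m n := lt_min hm hn
    rw [filter_modeOf_both k hm hn, dif_pos hk, h.sum_powerset_quadruple (by simp [indexA_inj])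
      indexA_ne_indexB indexA_ne_indexB indexA_ne_indexB indexA_ne_indexB (by simp [indexB_inj]) hp]
    simp only [canonicalCov_AA, canonicalCov_AB, canonicalCov_BB, if_true, padOne, dif_pos hk, matJ,
      matZ]
    have h1 : ν ⟨k, hk⟩ ^ 2 ≤ 1 := pow_le_one₀ (hν0 _) (hν1 _)
    have : ν ⟨k, hk⟩ * ν ⟨k, hk⟩ + √(1 - ν ⟨k, hk⟩ ^ 2) * √(1 - ν ⟨k, hk⟩ ^ 2) = 1 := by
      rw [Real.mul_self_sqrt (by linarith)]
      ring
    simp [abs_of_nonneg (hν0 _), abs_of_nonneg (Real.sqrt_nonneg _), Real.zero_rpow hp, this]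
    ring
  · have hk : ¬ (k : ℕ) < min m n := fun hk => hn (lt_min_iff.mp hk).2
    rw [filter_modeOf_left k hm hn, dif_neg hk, h.sum_powerset_pair (by simp [indexA_inj]) hp]
    simp [canonicalCov_AA, padOne, hn, matJ]
    norm_num
  · have hk : ¬ (k : ℕ) < min m n := fun hk => hm (lt_min_iff.mp hk).1
    rw [filter_modeOf_right k hm hn, dif_neg hk, h.sum_powerset_pair (by simp [indexB_inj]) hp]
    simp [canonicalCov_BB, padOne, hm, matJ]
    norm_num

end canonical

end IsGaussianWith

lemma prod_dite_lt {r s : ℕ} (hrs : r ≤ s) (f : Fin r → ℝ) (c : ℝ) :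
    ∏ k : Fin s, (if hk : (k : ℕ) < r then f ⟨k, hk⟩ else c) = (∏ k, f k) * c ^ (s - r) := by
  obtain ⟨t, rfl⟩ := Nat.exists_eq_add_of_le hrs
  rw [Fin.prod_univ_add]
  simp

/-! ### Normalization and entropies of the canonical form -/

/-- A real skew-symmetric complex structure `Γ` has `det (1 + Γ) = 2^L`. -/
lemma det_one_add_of_skew {L : ℕ} {Γ : Matrix (Fin (L * 2)) (Fin (L * 2)) ℝ} (ht : Γᵀ = -Γ)
    (hs : Γ * Γ = -1) : (1 + Γ).det = 2 ^ L := by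
  -- This fixes the determinant up to sign; the parameter `t` serves to connect `1 + Γ` with `1`.
  have hsq : ∀ t : ℝ, (1 + t • Γ).det ^ 2 = ((1 + t ^ 2) ^ L) ^ 2 := fun t => by
    have e : (1 + t • Γ) * (1 + t • Γ)ᵀ = (1 + t ^ 2) • 1 := by
      rw [Matrix.transpose_add, Matrix.transpose_one, Matrix.transpose_smul, ht, mul_add, mul_one,
        smul_neg, mul_neg, add_mul, one_mul, smul_mul_smul_comm, hs, add_smul, one_smul, ← pow_two,
        smul_neg]
      abel
    have := congrArg Matrix.det e
    rw [Matrix.det_mul, Matrix.det_transpose, Matrix.det_smul, Matrix.det_one, mul_one,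
      Fintype.card_fin, pow_mul] at this
    rw [← this, pow_two]
  -- The determinant is `1` at `t = 0` and never vanishes, so it stays positive.
  have hpos : 0 < (1 + (1 : ℝ) • Γ).det := by
    by_contra hneg
    have hc : Continuous fun t : ℝ => (1 + t • Γ).det := by fun_prop
    have h0 : (1 + (0 : ℝ) • Γ).det = 1 := by simp
    obtain ⟨t, -, h0t⟩ := intermediate_value_Icc' (zero_le_one' ℝ) hc.continuousOn
      (show (0 : ℝ) ∈ Set.Icc _ _ from ⟨not_lt.mp hneg, by simp⟩)
    have := hsq t
    rw [show (1 + t • Γ).det = 0 from h0t] at this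
    have : (0 : ℝ) < ((1 + t ^ 2) ^ L) ^ 2 := by positivity
    linarith
  have h1 := hsq 1
  rw [one_smul] at h1 hpos
  rw [sq_eq_sq₀ hpos.le (by positivity)] at h1
  rw [h1]
  norm_num

namespace IsGaussianWith

variable {m n : ℕ} {ψ : Bits (m + n) → ℂ} {ν : Fin (min m n) → ℝ}

lemma sum_norm_expect_canonical (h : IsGaussianWith ψ (canonicalCov m n ν)) (hν0 : ∀ k, 0 ≤ ν k)
    (hν1 : ∀ k, ν k ≤ 1)
    {p : ℝ} (hp : p ≠ 0) :
    ∑ X : Finset (Fin ((m + n) * 2)), ‖expect ψ (majoranaString X)‖ ^ p =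
      2 ^ (max m n) * ∏ k, (1 + ν k ^ p + √(1 - ν k ^ 2) ^ p) := by
  rw [h.sum_norm_expect_rpow modeOf (canonicalCov_eq_zero ν),
    Finset.prod_congr rfl fun k _ => h.sum_mode hν0 hν1 hp k,
    prod_dite_lt (min_le_max (a := m) (b := n))
      (fun k => 2 * (1 + ν k ^ p + √(1 - ν k ^ 2) ^ p)) 2,
    Finset.prod_mul_distrib, Finset.prod_const, Finset.card_univ, Fintype.card_fin, mul_right_comm,
    ← pow_add, Nat.add_sub_cancel' min_le_max]

lemma pfaffianMoment_canonical (h : IsGaussianWith ψ (canonicalCov m n ν)) (hν0 : ∀ k, 0 ≤ ν k)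
    (hν1 : ∀ k, ν k ≤ 1)
    {α : ℝ} (hα : 0 < α) :
    pfaffianMoment α (canonicalCov m n ν)
      = 2 ^ (max m n) * ∏ k, (1 + ν k ^ (2 * α) + √(1 - ν k ^ 2) ^ (2 * α)) := by
  rw [← h.sum_norm_expect_canonical hν0 hν1 (by positivity), ← h.stringMoment_eq]
  exact Finset.sum_congr rfl fun X _ => by rw [trace_pureDensity_mul]

lemma sreCov_canonical_eq (h : IsGaussianWith ψ (canonicalCov m n ν)) (α : ℝ) :
    sreCov α (canonicalCov m n ν) = 1 / (1 - α) * Real.log (∑ X : Finset (Fin ((m + n) * 2)),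
      (‖expect ψ (majoranaString X)‖ ^ 2 / 2 ^ (m + n)) ^ α) - Real.log (2 ^ (m + n)) := by
  rw [sreCov, det_one_add_of_skew h.transpose_eq h.mul_self]
  simp only [h.norm_expect_sq_canonical]
  rfl

lemma sre_eq_sreCov (h : IsGaussianWith ψ (canonicalCov m n ν)) (α : ℝ) :
    sre α (pureDensity ψ) = sreCov α (canonicalCov m n ν) := by
  rw [h.sreCov_canonical_eq, sre,
    sum_pauliString_eq_sum_majoranaString (fun x => (x ^ 2 / 2 ^ (m + n)) ^ α)]
  simp only [trace_pureDensity_mul]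

lemma sreCov_canonical (h : IsGaussianWith ψ (canonicalCov m n ν)) (hν0 : ∀ k, 0 ≤ ν k)
    (hν1 : ∀ k, ν k ≤ 1) {α : ℝ}
    (hα : 0 < α) (hα1 : α ≠ 1) :
    sreCov α (canonicalCov m n ν) = 1 / (1 - α) *
      ∑ k, Real.log ((1 + ν k ^ (2 * α) + √(1 - ν k ^ 2) ^ (2 * α)) / 2) := by
  have hpos : ∀ k, 0 < 1 + ν k ^ (2 * α) + √(1 - ν k ^ 2) ^ (2 * α) := fun k => by
    have := Real.rpow_nonneg (hν0 k) (2 * α)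
    positivity
  have e : ∀ x : ℝ, 0 ≤ x → (x ^ 2 / 2 ^ (m + n)) ^ α = x ^ (2 * α) / (2 ^ (m + n)) ^ α :=
    fun x hx => by
      rw [Real.div_rpow (by positivity) (by positivity), Real.rpow_mul hx, Real.rpow_two]
  rw [h.sreCov_canonical_eq]
  simp only [e _ (norm_nonneg _)]
  rw [← Finset.sum_div, h.sum_norm_expect_canonical hν0 hν1 (by positivity),
    Real.log_div (mul_ne_zero (by positivity) (Finset.prod_ne_zero_iff.mpr fun k _ => (hpos k).ne'))
      (by positivity),
    Real.log_mul (by positivity) (Finset.prod_ne_zero_iff.mpr fun k _ => (hpos k).ne'),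
    Real.log_prod (fun k _ => (hpos k).ne'), Real.log_rpow (by positivity),
    Finset.sum_congr rfl fun k _ => Real.log_div (hpos k).ne' two_ne_zero, Finset.sum_sub_distrib,
    Finset.sum_const, Finset.card_univ, Fintype.card_fin, nsmul_eq_mul, Real.log_pow, Real.log_pow]
  -- The powers of two combine to the exponent `max m n - (m + n) = -min m n`, which is one factor
  -- `1/2` for each `k`.
  have hL : ((max m n : ℕ) : ℝ) = (m + n : ℕ) - (min m n : ℕ) := by
    rw [eq_sub_iff_add_eq]
    exact_mod_cast max_add_min m n
  rw [hL]
  have : (1 - α) ≠ 0 := sub_ne_zero.mpr hα1.symm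
  field_simp
  ring

end IsGaussianWith

/-! ### Simultaneous normal form of the blocks of an orthogonal complex structure -/

section normalForm

open scoped RealInnerProductSpace

/-- The blocks of a skew-symmetric operator `[[A, C'], [-C, D]]` with square `-1` on `E ⊕ F`. -/
structure IsSkewSplit {E F : Type*} [NormedAddCommGroup E] [InnerProductSpace ℝ E]
    [NormedAddCommGroup F] [InnerProductSpace ℝ F] (A : E →ₗ[ℝ] E) (C : E →ₗ[ℝ] F)
    (C' : F →ₗ[ℝ] E) (D : F →ₗ[ℝ] F) : Prop where
  skewA : ∀ x y, ⟪A x, y⟫ = -⟪x, A y⟫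
  skewD : ∀ x y, ⟪D x, y⟫ = -⟪x, D y⟫
  adj : ∀ x y, ⟪C x, y⟫ = ⟪x, C' y⟫
  sqA : ∀ x, A (A x) = C' (C x) - x
  sqD : ∀ y, D (D y) = C (C' y) - y
  commDC : ∀ x, D (C x) = -C (A x)
  commAC : ∀ y, A (C' y) = -C' (D y)

/-- Orthonormal pairs spanning one pair of modes in the normal form. -/
structure IsModePair {E F : Type*} [NormedAddCommGroup E] [InnerProductSpace ℝ E]
    [NormedAddCommGroup F] [InnerProductSpace ℝ F] (A : E →ₗ[ℝ] E) (C : E →ₗ[ℝ] F)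
    (C' : F →ₗ[ℝ] E) (D : F →ₗ[ℝ] F) (ν : ℝ) (u : Fin 2 → E) (v : Fin 2 → F) : Prop where
  orthE : Orthonormal ℝ u
  orthF : Orthonormal ℝ v
  A0 : A (u 0) = -ν • u 1
  A1 : A (u 1) = ν • u 0
  D0 : D (v 0) = -ν • v 1
  D1 : D (v 1) = ν • v 0
  C0 : C (u 0) = √(1 - ν ^ 2) • v 0
  C1 : C (u 1) = -√(1 - ν ^ 2) • v 1
  C'0 : C' (v 0) = √(1 - ν ^ 2) • u 0
  C'1 : C' (v 1) = -√(1 - ν ^ 2) • u 1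

/-! ### Existence of one pair of modes -/

lemma orthonormal_pair {E : Type*} [NormedAddCommGroup E] [InnerProductSpace ℝ E] {u : Fin 2 → E}
    (h0 : ⟪u 0, u 0⟫ = 1) (h1 : ⟪u 1, u 1⟫ = 1) (h01 : ⟪u 0, u 1⟫ = 0) : Orthonormal ℝ u := by
  rw [orthonormal_iff_ite]
  have h10 : ⟪u 1, u 0⟫ = 0 := by rw [real_inner_comm, h01]
  simp only [Fin.forall_fin_two]
  simp only [h0, h1, h01, h10]
  simp

/-- In odd dimension `det A = det Aᵀ = det (-A) = -det A`. -/
lemma exists_ker_of_skew_of_odd {E : Type*} [NormedAddCommGroup E] [InnerProductSpace ℝ E]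
    [FiniteDimensional ℝ E] (hE : Odd (Module.finrank ℝ E)) (A : E →ₗ[ℝ] E)
    (hA : ∀ x y, ⟪A x, y⟫ = -⟪x, A y⟫) : ∃ x, x ≠ 0 ∧ A x = 0 := by
  let b := stdOrthonormalBasis ℝ E
  set M := LinearMap.toMatrix b.toBasis b.toBasis A with hM
  have hskew : Mᵀ = -M := by
    ext i j
    simp only [hM, Matrix.transpose_apply, Matrix.neg_apply, LinearMap.toMatrix_apply,
      OrthonormalBasis.coe_toBasis, OrthonormalBasis.coe_toBasis_repr_apply,
      OrthonormalBasis.repr_apply_apply]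
    rw [← hA, real_inner_comm]
  have hdet : M.det = 0 := by
    have := congrArg Matrix.det hskew
    rw [Matrix.det_transpose, Matrix.det_neg, Fintype.card_fin, hE.neg_one_pow] at this
    linarith
  rw [hM, LinearMap.det_toMatrix] at hdet
  obtain ⟨x, hx, hx0⟩ := (Submodule.ne_bot_iff _).mp (LinearMap.bot_lt_ker_of_det_eq_zero hdet).ne'
  exact ⟨x, hx0, hx⟩

lemma skew_inner_self {E : Type*} [NormedAddCommGroup E] [InnerProductSpace ℝ E]
    {A : E →ₗ[ℝ] E} (hA : ∀ x y, ⟪A x, y⟫ = -⟪x, A y⟫) (x : E) : ⟪A x, x⟫ = 0 := by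
  linarith [hA x x, real_inner_comm x (A x)]

lemma exists_orthonormal_pair_of_sq {E : Type*} [NormedAddCommGroup E] [InnerProductSpace ℝ E]
    {A : E →ₗ[ℝ] E} (hA : ∀ x y, ⟪A x, y⟫ = -⟪x, A y⟫) [Nontrivial E]
    (hsq : ∀ x, A (A x) = -x) :
    ∃ u : Fin 2 → E, Orthonormal ℝ u ∧ A (u 0) = -u 1 ∧ A (u 1) = u 0 := by
  obtain ⟨x, hx⟩ := exists_norm_eq E (zero_le_one' ℝ)
  have hxx : ⟪x, x⟫ = 1 := by rw [real_inner_self_eq_norm_sq, hx, one_pow]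
  refine ⟨![A x, x], orthonormal_pair ?_ hxx (skew_inner_self hA x), hsq x, rfl⟩
  change ⟪A x, A x⟫ = 1
  rw [hA, hsq, inner_neg_right, neg_neg, hxx]

namespace IsSkewSplit

variable {E F : Type*} [NormedAddCommGroup E] [InnerProductSpace ℝ E]
    [NormedAddCommGroup F] [InnerProductSpace ℝ F] {A : E →ₗ[ℝ] E} {C : E →ₗ[ℝ] F}
    {C' : F →ₗ[ℝ] E} {D : F →ₗ[ℝ] F}

/-- On the plane of `u`, `C'C = 1 + A² = μ²`, and `μ ≠ 0`, so `μ⁻¹ C` is isometric there. Since `DC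
= -CA`, it reverses the orientation of the rotation; negating the second image vector repairs this,
and is the reason why the coupling is `μ Z` and not `μ` times the identity. -/
lemma exists_isModePair_of_lt (h : IsSkewSplit A C C' D) {ν : ℝ} (h0 : 0 ≤ ν) (h1 : ν < 1)
    {u : Fin 2 → E} (hu : Orthonormal ℝ u) (hA0 : A (u 0) = -ν • u 1) (hA1 : A (u 1) = ν • u 0) :
    ∃ v, IsModePair A C C' D ν u v := by
  set μ := √(1 - ν ^ 2) with hμ
  have hpos : 0 < 1 - ν ^ 2 := by nlinarith
  have hμ0 : μ ≠ 0 := (Real.sqrt_pos.mpr hpos).ne'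
  have hμμ : μ * μ = 1 - ν ^ 2 := Real.mul_self_sqrt hpos.le
  have hCC : ∀ i, C' (C (u i)) = (μ * μ) • u i := fun i => by
    have := h.sqA (u i)
    rw [eq_sub_iff_add_eq] at this
    rw [← this, hμμ]
    rcases (by omega : i = 0 ∨ i = 1) with rfl | rfl
    · rw [hA0, map_smul, hA1]
      module
    · rw [hA1, map_smul, hA0]
      module
  have hin : ∀ i j, ⟪C (u i), C (u j)⟫ = μ * μ * if i = j then 1 else 0 := fun i j => by
    rw [h.adj, hCC, inner_smul_right, orthonormal_iff_ite.mp hu]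
  refine ⟨![μ⁻¹ • C (u 0), -μ⁻¹ • C (u 1)], hu, orthonormal_pair ?_ ?_ ?_, hA0, hA1, ?_, ?_, ?_, ?_,
    ?_, ?_⟩
  · change ⟪μ⁻¹ • C (u 0), μ⁻¹ • C (u 0)⟫ = 1
    rw [real_inner_smul_left, real_inner_smul_right, hin, if_pos rfl]
    field_simp
  · change ⟪-μ⁻¹ • C (u 1), -μ⁻¹ • C (u 1)⟫ = 1
    rw [real_inner_smul_left, real_inner_smul_right, hin, if_pos rfl]
    field_simp
  · simp [inner_smul_left, inner_smul_right, hin]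
  · simp [h.commDC, hA0, smul_smul, mul_comm]
  · simp [h.commDC, hA1, smul_smul, mul_comm]
  · simp [smul_smul, ← hμ, hμ0]
  · simp [smul_smul, ← hμ, hμ0]
  · simp [smul_smul, ← hμ, hμ0, hCC]
  · simp [smul_smul, ← hμ, hμ0, hCC]

/-- If `C = 0`, both `A` and `D` are complex structures and `ν = 1`. Otherwise take a unit
eigenvector `x` of `C'C` with eigenvalue `λ > 0`. Then `A²x = -(1 - λ)x`, so `λ ≤ 1`, and for `λ <
1` the plane of `x` and `Ax` works with `ν = √(1 - λ)`. -/
lemma exists_isModePair [FiniteDimensional ℝ E] (h : IsSkewSplit A C C' D)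
    [Nontrivial E] [Nontrivial F] (hE : Even (Module.finrank ℝ E)) :
    ∃ ν u v, 0 ≤ ν ∧ ν ≤ 1 ∧ IsModePair A C C' D ν u v := by
  by_cases hC : ∀ x, C x = 0
  · have hC' : ∀ y, C' y = 0 := fun y => by
      rw [← inner_self_eq_zero (𝕜 := ℝ), ← h.adj, hC, inner_zero_left]
    obtain ⟨u, hu, hu0, hu1⟩ := exists_orthonormal_pair_of_sq h.skewA fun x => by
      rw [h.sqA, hC', zero_sub]
    obtain ⟨v, hv, hv0, hv1⟩ := exists_orthonormal_pair_of_sq h.skewD fun x => by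
      rw [h.sqD, hC, zero_sub]
    exact ⟨1, u, v, zero_le_one, le_rfl, hu, hv, by simp [hu0], by simp [hu1], by simp [hv0],
      by simp [hv1], by simp [hC], by simp [hC], by simp [hC'], by simp [hC']⟩
  have hT : (C' ∘ₗ C).IsSymmetric := fun x y => by
    rw [LinearMap.comp_apply, LinearMap.comp_apply, ← h.adj, real_inner_comm, ← h.adj,
      real_inner_comm]
  obtain ⟨i, hi⟩ : ∃ i, hT.eigenvalues rfl i ≠ 0 := by
    by_contra! hall
    have hz : C' ∘ₗ C = 0 := (hT.eigenvectorBasis rfl).toBasis.ext fun i => by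
      rw [OrthonormalBasis.coe_toBasis, hT.apply_eigenvectorBasis, hall]
      simp
    refine hC fun x => ?_
    rw [← inner_self_eq_zero (𝕜 := ℝ), h.adj, ← LinearMap.comp_apply, hz, LinearMap.zero_apply,
      inner_zero_right]
  set x := hT.eigenvectorBasis rfl i
  set lam := hT.eigenvalues rfl i
  have hCx : C' (C x) = lam • x := hT.apply_eigenvectorBasis rfl i
  have hxx : ⟪x, x⟫ = 1 := by
    rw [real_inner_self_eq_norm_sq, (hT.eigenvectorBasis rfl).norm_eq_one, one_pow]
  have hlam : 0 < lam := by
    refine lt_of_le_of_ne ?_ hi.symm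
    have : ⟪C x, C x⟫ = lam := by rw [h.adj, hCx, inner_smul_right, hxx, mul_one]
    rw [← this]
    exact real_inner_self_nonneg
  have hAA : A (A x) = -(1 - lam) • x := by
    rw [h.sqA, hCx]
    module
  have hAx : ⟪A x, A x⟫ = 1 - lam := by
    rw [h.skewA, hAA, inner_smul_right, hxx]
    ring
  have hlam1 : 0 ≤ 1 - lam := hAx ▸ real_inner_self_nonneg
  rcases hlam1.eq_or_lt with he | hlt
  -- For `λ = 1` the vector `Ax` vanishes and gives no partner for `x`. As `E` is even-dimensional,
  -- the `A`-invariant complement of `x` has odd dimension and contains a second kernel vector, so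
  -- `ν = 0`.
  · have hAx0 : A x = 0 := by
      rw [← inner_self_eq_zero (𝕜 := ℝ), hAx, ← he]
    have hinv : ∀ y ∈ (ℝ ∙ x)ᗮ, A y ∈ (ℝ ∙ x)ᗮ := fun y hy => by
      rw [Submodule.mem_orthogonal_singleton_iff_inner_left] at hy ⊢
      rw [h.skewA, hAx0, inner_zero_right, neg_zero]
    have hx0 : x ≠ 0 := fun e => by simp [e] at hxx
    have hodd : Odd (Module.finrank ℝ (ℝ ∙ x)ᗮ) := by
      have := Submodule.finrank_add_finrank_orthogonal (ℝ ∙ x)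
      rw [finrank_span_singleton hx0] at this
      rw [← this, add_comm, Nat.even_add_one, Nat.not_even_iff_odd] at hE
      exact hE
    obtain ⟨y, hy0, hy⟩ := exists_ker_of_skew_of_odd hodd (A.restrict hinv)
      fun a b => h.skewA a b
    have hAy : A y = 0 := congrArg Subtype.val hy
    have hny : ‖(y : E)‖ ≠ 0 := by simpa using hy0
    have hyx : ⟪x, (y : E)⟫ = 0 := Submodule.mem_orthogonal_singleton_iff_inner_right.mp y.2
    obtain ⟨v, hv⟩ := h.exists_isModePair_of_lt (ν := 0) (u := ![x, ‖(y : E)‖⁻¹ • (y : E)]) le_rfl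
      zero_lt_one (orthonormal_pair hxx (by
        change ⟪‖(y : E)‖⁻¹ • (y : E), ‖(y : E)‖⁻¹ • (y : E)⟫ = 1
        rw [real_inner_smul_left, real_inner_smul_right, real_inner_self_eq_norm_sq]
        field_simp) (by
        simp [inner_smul_right, hyx])) (by simp [hAx0]) (by simp [hAy])
    exact ⟨0, _, v, le_rfl, zero_le_one, hv⟩
  · set ν := √(1 - lam) with hν
    have hν0 : 0 < ν := Real.sqrt_pos.mpr hlt
    have hνν : ν * ν = 1 - lam := Real.mul_self_sqrt hlam1
    have hν1 : ν < 1 := by nlinarith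
    obtain ⟨v, hv⟩ := h.exists_isModePair_of_lt (ν := ν) (u := ![x, -ν⁻¹ • A x]) hν0.le hν1
      (orthonormal_pair hxx (by
        change ⟪-ν⁻¹ • A x, -ν⁻¹ • A x⟫ = 1
        rw [real_inner_smul_left, real_inner_smul_right, hAx, ← hνν]
        field_simp) (by
        simp [inner_smul_right]
        right
        rw [real_inner_comm, skew_inner_self h.skewA])) (by
        simp [smul_smul, hν0.ne']) (by
        simp only [Matrix.cons_val_one, Matrix.cons_val_zero, Matrix.cons_val_fin_one, map_smul,
          hAA, ← hνν, smul_smul]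
        congr 1
        field_simp)
    exact ⟨ν, _, v, hν0.le, hν1.le, hv⟩

end IsSkewSplit

/-! #### Splitting off a pair -/

section complement

variable {E : Type*} [NormedAddCommGroup E] [InnerProductSpace ℝ E]

/-- The orthogonal complement of a pair of vectors. -/
noncomputable abbrev pairComplement (u : Fin 2 → E) : Submodule ℝ E :=
  (Submodule.span ℝ (Set.range u))ᗮ

lemma mem_pairComplement {u : Fin 2 → E} {x : E} :
    x ∈ pairComplement u ↔ ⟪u 0, x⟫ = 0 ∧ ⟪u 1, x⟫ = 0 := by
  rw [pairComplement, Submodule.mem_orthogonal]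
  constructor
  · exact fun h => ⟨h _ (Submodule.subset_span ⟨0, rfl⟩), h _ (Submodule.subset_span ⟨1, rfl⟩)⟩
  · rintro ⟨h0, h1⟩ y hy
    induction hy using Submodule.span_induction with
    | mem y hy =>
      obtain ⟨i, rfl⟩ := hy
      rcases (by omega : i = 0 ∨ i = 1) with rfl | rfl <;> assumption
    | zero => simp
    | add y z _ _ hy hz => rw [inner_add_left, hy, hz, add_zero]
    | smul c y _ hy => rw [inner_smul_left, hy, mul_zero]

lemma finrank_pairComplement [FiniteDimensional ℝ E] {u : Fin 2 → E} (hu : Orthonormal ℝ u) {m : ℕ}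
    (hE : Module.finrank ℝ E = (m + 1) * 2) : Module.finrank ℝ (pairComplement u) = m * 2 := by
  have := Submodule.finrank_add_finrank_orthogonal (Submodule.span ℝ (Set.range u))
  rw [finrank_span_eq_card hu.linearIndependent, Fintype.card_fin] at this
  change 2 + Module.finrank ℝ (pairComplement u) = _ at this
  omega

end complement

/-- Orthonormal families of pairs. -/
def IsPairFamily {E : Type*} [NormedAddCommGroup E] [InnerProductSpace ℝ E] {m : ℕ}
    (a : Fin m → Fin 2 → E) : Prop :=
  ∀ k l i j, ⟪a k i, a l j⟫ = if k = l then (1 : Matrix (Fin 2) (Fin 2) ℝ) i j else 0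

/-- The matrix of `A` in a family of pairs is `⨁ ν_k J`. -/
def HasModes {E : Type*} [NormedAddCommGroup E] [InnerProductSpace ℝ E] (A : E →ₗ[ℝ] E)
    (ν : ℕ → ℝ) {m : ℕ} (a : Fin m → Fin 2 → E) : Prop :=
  ∀ k l i j, ⟪a k i, A (a l j)⟫ = if k = l then ν k * matJ i j else 0

/-- The matrix of `C'` in two families of pairs is `⨁ √(1 - ν_k²) Z`. -/
def HasCoupling {E F : Type*} [NormedAddCommGroup E] [InnerProductSpace ℝ E]
    [NormedAddCommGroup F] [InnerProductSpace ℝ F] (C' : F →ₗ[ℝ] E) (ν : ℕ → ℝ) {m n : ℕ}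
    (a : Fin m → Fin 2 → E) (b : Fin n → Fin 2 → F) : Prop :=
  ∀ k l i j, ⟪a k i, C' (b l j)⟫ = if (k : ℕ) = l then √(1 - ν k ^ 2) * matZ i j else 0

/-- A sequence starting with `x`. -/
def consSeq (x : ℝ) (ν : ℕ → ℝ) : ℕ → ℝ
  | 0 => x
  | k + 1 => ν k

section cons

variable {E F : Type*} [NormedAddCommGroup E] [InnerProductSpace ℝ E]
    [NormedAddCommGroup F] [InnerProductSpace ℝ F]

lemma inner_complement_right {u : Fin 2 → E} (x : pairComplement u) (i : Fin 2) :
    ⟪u i, (x : E)⟫ = 0 := by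
  have := mem_pairComplement.mp x.2
  rcases (by omega : i = 0 ∨ i = 1) with rfl | rfl
  exacts [this.1, this.2]

lemma inner_complement_left {u : Fin 2 → E} (x : pairComplement u) (i : Fin 2) :
    ⟪(x : E), u i⟫ = 0 := by
  rw [real_inner_comm, inner_complement_right]

lemma IsPairFamily.cons {u : Fin 2 → E} (hu : Orthonormal ℝ u) {m : ℕ}
    {a : Fin m → Fin 2 → pairComplement u} (ha : IsPairFamily a) :
    IsPairFamily (Fin.cons u (fun k i => (a k i : E)) : Fin (m + 1) → Fin 2 → E) := by
  intro k l i j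
  induction k using Fin.cases with
  | zero =>
    induction l using Fin.cases with
    | zero => simp [orthonormal_iff_ite.mp hu, Matrix.one_apply]
    | succ l => simp [inner_complement_right, (Fin.succ_ne_zero l).symm]
  | succ k =>
    induction l using Fin.cases with
    | zero => simp [inner_complement_left, Fin.succ_ne_zero]
    | succ l => simpa using ha k l i j

lemma HasModes.cons {A : E →ₗ[ℝ] E} {u : Fin 2 → E} (hu : Orthonormal ℝ u) {ν₀ : ℝ}
    (h0 : A (u 0) = -ν₀ • u 1) (h1 : A (u 1) = ν₀ • u 0)
    (hinv : ∀ x ∈ pairComplement u, A x ∈ pairComplement u) {ν : ℕ → ℝ} {m : ℕ}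
    {a : Fin m → Fin 2 → pairComplement u} (ha : HasModes (A.restrict hinv) ν a) :
    HasModes A (consSeq ν₀ ν) (Fin.cons u (fun k i => (a k i : E)) : Fin (m + 1) → Fin 2 → E) := by
  intro k l i j
  induction k using Fin.cases with
  | zero =>
    induction l using Fin.cases with
    | zero =>
      have hu' := orthonormal_iff_ite.mp hu
      rcases (by omega : i = 0 ∨ i = 1) with rfl | rfl <;>
      rcases (by omega : j = 0 ∨ j = 1) with rfl | rfl <;>
      simp [h0, h1, inner_smul_right, hu', hu.norm_eq_one, matJ, consSeq]
    | succ l =>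
      simpa [(Fin.succ_ne_zero l).symm] using
        inner_complement_right ⟨A (a l j), hinv _ (a l j).2⟩ i
  | succ k =>
    induction l using Fin.cases with
    | zero =>
      rcases (by omega : j = 0 ∨ j = 1) with rfl | rfl <;>
      simp [h0, h1, inner_smul_right, inner_complement_left, Fin.succ_ne_zero]
    | succ l => simpa [consSeq] using ha k l i j

lemma HasCoupling.cons {C' : F →ₗ[ℝ] E} {u : Fin 2 → E} {v : Fin 2 → F} (hu : Orthonormal ℝ u)
    {ν₀ : ℝ} (h0 : C' (v 0) = √(1 - ν₀ ^ 2) • u 0) (h1 : C' (v 1) = -√(1 - ν₀ ^ 2) • u 1)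
    (hinv : ∀ x ∈ pairComplement v, C' x ∈ pairComplement u) {ν : ℕ → ℝ} {m n : ℕ}
    {a : Fin m → Fin 2 → pairComplement u} {b : Fin n → Fin 2 → pairComplement v}
    (hab : HasCoupling (C'.restrict hinv) ν a b) :
    HasCoupling C' (consSeq ν₀ ν) (Fin.cons u (fun k i => (a k i : E)) : Fin (m + 1) → Fin 2 → E)
      (Fin.cons v (fun k i => (b k i : F)) : Fin (n + 1) → Fin 2 → F) := by
  intro k l i j
  induction k using Fin.cases with
  | zero =>
    induction l using Fin.cases with
    | zero =>
      have hu' := orthonormal_iff_ite.mp hu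
      rcases (by omega : i = 0 ∨ i = 1) with rfl | rfl <;>
      rcases (by omega : j = 0 ∨ j = 1) with rfl | rfl <;>
      simp [h0, h1, inner_smul_right, hu', hu.norm_eq_one, matZ, consSeq]
    | succ l =>
      simpa using inner_complement_right ⟨C' (b l j), hinv _ (b l j).2⟩ i
  | succ k =>
    induction l using Fin.cases with
    | zero =>
      rcases (by omega : j = 0 ∨ j = 1) with rfl | rfl <;>
      simp [h0, h1, inner_smul_right, inner_complement_left]
    | succ l => simpa [consSeq] using hab k l i j

end cons

/-! ### Induction on the number of modes -/

lemma skew_pairComplement {E : Type*} [NormedAddCommGroup E] [InnerProductSpace ℝ E]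
    {A : E →ₗ[ℝ] E} (hA : ∀ x y, ⟪A x, y⟫ = -⟪x, A y⟫) {u : Fin 2 → E} {ν : ℝ}
    (h0 : A (u 0) = -ν • u 1) (h1 : A (u 1) = ν • u 0) :
    ∀ x ∈ pairComplement u, A x ∈ pairComplement u := by
  intro x hx
  rw [mem_pairComplement] at hx ⊢
  constructor
  · rw [real_inner_comm, hA, h0, inner_smul_right, real_inner_comm, hx.2]
    simp
  · rw [real_inner_comm, hA, h1, inner_smul_right, real_inner_comm, hx.1]
    simp

/-- Handles the modes left over on the larger side once the smaller side is exhausted. -/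
lemma exists_complexStructure_basis (m : ℕ) {E : Type*} [NormedAddCommGroup E]
    [InnerProductSpace ℝ E] [FiniteDimensional ℝ E] (hE : Module.finrank ℝ E = m * 2)
    {A : E →ₗ[ℝ] E} (hA : ∀ x y, ⟪A x, y⟫ = -⟪x, A y⟫) (hsq : ∀ x, A (A x) = -x) :
    ∃ a : Fin m → Fin 2 → E, IsPairFamily a ∧ HasModes A (fun _ => 1) a := by
  induction m generalizing E with
  | zero => exact ⟨Fin.elim0, fun k => k.elim0, fun k => k.elim0⟩
  | succ m ih =>
    have : Nontrivial E := Module.nontrivial_of_finrank_pos (R := ℝ) (by omega)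
    obtain ⟨u, hu, h0, h1⟩ := exists_orthonormal_pair_of_sq hA hsq
    have h0' : A (u 0) = -(1 : ℝ) • u 1 := by rw [h0]; simp
    have h1' : A (u 1) = (1 : ℝ) • u 0 := by rw [h1]; simp
    have hinv := skew_pairComplement hA h0' h1'
    obtain ⟨a, ha, ha'⟩ := ih (finrank_pairComplement hu hE) (A := A.restrict hinv)
      (fun x y => hA x y) fun x => Subtype.ext (hsq x)
    refine ⟨_, ha.cons hu, ?_⟩
    convert ha'.cons hu h0' h1' hinv using 1
    funext k
    cases k <;> rfl

/-- One pair of planes is split off, and all four maps restrict to the orthogonal complements, where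
the hypotheses persist. Indexing `ν` by `ℕ`, with value `1` from `min m n` on, lets both sides share
one sequence. -/
theorem IsSkewSplit.exists_normalForm (m n : ℕ) {E F : Type*} [NormedAddCommGroup E]
    [InnerProductSpace ℝ E] [FiniteDimensional ℝ E] [NormedAddCommGroup F]
    [InnerProductSpace ℝ F] [FiniteDimensional ℝ F] (hE : Module.finrank ℝ E = m * 2)
    (hF : Module.finrank ℝ F = n * 2) {A : E →ₗ[ℝ] E} {C : E →ₗ[ℝ] F} {C' : F →ₗ[ℝ] E}
    {D : F →ₗ[ℝ] F} (h : IsSkewSplit A C C' D) :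
    ∃ (ν : ℕ → ℝ) (a : Fin m → Fin 2 → E) (b : Fin n → Fin 2 → F),
      (∀ k, 0 ≤ ν k ∧ ν k ≤ 1) ∧ (∀ k, min m n ≤ k → ν k = 1) ∧ IsPairFamily a ∧
        IsPairFamily b ∧ HasModes A ν a ∧ HasModes D ν b ∧ HasCoupling C' ν a b := by
  induction m generalizing n E F with
  | zero =>
    have : Subsingleton E := Module.finrank_zero_iff (R := ℝ).mp (by simpa using hE)
    obtain ⟨b, hb, hb'⟩ := exists_complexStructure_basis n hF h.skewD fun y => by
      rw [h.sqD, Subsingleton.elim (C' y) 0, map_zero, zero_sub]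
    exact ⟨fun _ => 1, Fin.elim0, b, by simp, by simp, fun k => k.elim0, hb, fun k => k.elim0, hb',
      fun k => k.elim0⟩
  | succ m ih =>
    cases n with
    | zero =>
      have : Subsingleton F := Module.finrank_zero_iff (R := ℝ).mp (by simpa using hF)
      obtain ⟨a, ha, ha'⟩ := exists_complexStructure_basis _ hE h.skewA fun y => by
        rw [h.sqA, Subsingleton.elim (C y) 0, map_zero, zero_sub]
      exact ⟨fun _ => 1, a, Fin.elim0, by simp, by simp, ha, fun k => k.elim0, ha',
        fun k => k.elim0, fun k l => l.elim0⟩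
    | succ n =>
      have : Nontrivial E := Module.nontrivial_of_finrank_pos (R := ℝ) (by omega)
      have : Nontrivial F := Module.nontrivial_of_finrank_pos (R := ℝ) (by omega)
      obtain ⟨ν₀, u, v, hν0, hν1, hp⟩ := h.exists_isModePair (by rw [hE]; exact even_two.mul_left _)
      have hA := skew_pairComplement h.skewA hp.A0 hp.A1
      have hD := skew_pairComplement h.skewD hp.D0 hp.D1
      have hC : ∀ x ∈ pairComplement u, C x ∈ pairComplement v := fun x hx => by
        rw [mem_pairComplement] at hx ⊢
        rw [real_inner_comm, h.adj, hp.C'0, real_inner_comm (C x), h.adj, hp.C'1,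
          real_inner_smul_right, real_inner_smul_right, real_inner_comm, hx.1, real_inner_comm, hx.2]
        simp
      have hC' : ∀ y ∈ pairComplement v, C' y ∈ pairComplement u := fun y hy => by
        rw [mem_pairComplement] at hy ⊢
        rw [← h.adj, hp.C0, ← h.adj, hp.C1]
        simp [inner_smul_left, hy.1, hy.2]
      obtain ⟨ν, a, b, hν, hν', ha, hb, haA, hbD, hab⟩ := ih n (finrank_pairComplement hp.orthE hE)
        (finrank_pairComplement hp.orthF hF) (A := A.restrict hA) (C := C.restrict hC)
        (C' := C'.restrict hC') (D := D.restrict hD)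
        ⟨fun x y => h.skewA x y, fun x y => h.skewD x y, fun x y => h.adj x y,
          fun x => Subtype.ext (h.sqA x), fun x => Subtype.ext (h.sqD x),
          fun x => Subtype.ext (h.commDC x), fun x => Subtype.ext (h.commAC x)⟩
      refine ⟨consSeq ν₀ ν, _, _, ?_, ?_, ha.cons hp.orthE, hb.cons hp.orthF,
        haA.cons hp.orthE hp.A0 hp.A1 hA, hbD.cons hp.orthF hp.D0 hp.D1 hD,
        hab.cons hp.orthE hp.C'0 hp.C'1 hC'⟩
      · rintro (_ | k)
        exacts [⟨hν0, hν1⟩, hν k]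
      · rintro (_ | k) hk
        · simp at hk
        · exact hν' k (by omega)

end normalForm

/-! ### The normal form of a covariance matrix -/

lemma mul_mul_transpose_apply {ι κ ι' κ' : Type*} [Fintype κ] [Fintype κ']
    (P : Matrix ι κ ℝ) (M : Matrix κ κ' ℝ) (Q : Matrix ι' κ' ℝ) (p : ι) (q : ι') :
    (P * M * Qᵀ) p q = P p ⬝ᵥ (M *ᵥ Q q) := by
  rw [Matrix.mul_assoc, Matrix.mul_apply]
  rfl

lemma inner_toEuclideanLin {ι κ : Type*} [Fintype ι] [Fintype κ] [DecidableEq κ]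
    (M : Matrix ι κ ℝ) (x : EuclideanSpace ℝ ι) (y : EuclideanSpace ℝ κ) :
    inner ℝ x (Matrix.toEuclideanLin M y) = x.ofLp ⬝ᵥ (M *ᵥ y.ofLp) := by
  rw [EuclideanSpace.inner_eq_star_dotProduct, star_trivial, dotProduct_comm]
  rfl

lemma inner_toEuclideanLin_transpose {ι κ : Type*} [Fintype ι] [Fintype κ] [DecidableEq κ]
    [DecidableEq ι] (M : Matrix ι κ ℝ) (x : EuclideanSpace ℝ ι) (y : EuclideanSpace ℝ κ) :
    inner ℝ (Matrix.toEuclideanLin Mᵀ x) y = inner ℝ x (Matrix.toEuclideanLin M y) := by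
  rw [real_inner_comm, inner_toEuclideanLin, inner_toEuclideanLin, Matrix.dotProduct_mulVec,
    Matrix.vecMul_transpose, dotProduct_comm]

/-- The matrix whose rows are the vectors of a family of pairs. -/
def rowMatrix {m : ℕ} (a : Fin m → Fin 2 → EuclideanSpace ℝ (Fin (m * 2))) :
    Matrix (Fin (m * 2)) (Fin (m * 2)) ℝ :=
  Matrix.of fun p => (a p.divNat p.modNat).ofLp

lemma rowMatrix_apply {m : ℕ} (a : Fin m → Fin 2 → EuclideanSpace ℝ (Fin (m * 2))) (k : Fin m)
    (i : Fin 2) : rowMatrix a (finProdFinEquiv (k, i)) = (a k i).ofLp := by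
  have h := finProdFinEquiv.symm_apply_apply (k, i)
  have h1 : (finProdFinEquiv (k, i)).divNat = k := congrArg Prod.fst h
  have h2 : (finProdFinEquiv (k, i)).modNat = i := congrArg Prod.snd h
  change (a (finProdFinEquiv (k, i)).divNat (finProdFinEquiv (k, i)).modNat).ofLp = _
  rw [h1, h2]

lemma IsPairFamily.rowMatrix_mem {m : ℕ} {a : Fin m → Fin 2 → EuclideanSpace ℝ (Fin (m * 2))}
    (ha : IsPairFamily a) : rowMatrix a ∈ Matrix.orthogonalGroup (Fin (m * 2)) ℝ := by
  rw [Matrix.mem_unitaryGroup_iff, Matrix.star_eq_conjTranspose,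
    Matrix.conjTranspose_eq_transpose_of_trivial]
  ext p q
  obtain ⟨⟨k, i⟩, rfl⟩ := finProdFinEquiv.surjective p
  obtain ⟨⟨l, j⟩, rfl⟩ := finProdFinEquiv.surjective q
  have h := ha k l i j
  rw [EuclideanSpace.inner_eq_star_dotProduct, star_trivial, dotProduct_comm] at h
  have e := mul_mul_transpose_apply (rowMatrix a) 1 (rowMatrix a) (finProdFinEquiv (k, i))
    (finProdFinEquiv (l, j))
  rw [mul_one, rowMatrix_apply, rowMatrix_apply, Matrix.one_mulVec, h] at e
  rw [e]
  simp only [Matrix.one_apply, EmbeddingLike.apply_eq_iff_eq, Prod.mk.injEq]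
  split_ifs <;> tauto

/-- Blockwise, skewness and `Γ² = -1` are the conditions of `IsSkewSplit`; the vectors of the normal
form become the rows of `O_A` and `O_B`. -/
theorem exists_canonicalCov {m n : ℕ} {Γ : Matrix (Fin ((m + n) * 2)) (Fin ((m + n) * 2)) ℝ}
    (ht : Γᵀ = -Γ) (hs : Γ * Γ = -1) :
    ∃ ν : Fin (min m n) → ℝ, (∀ k, 0 ≤ ν k) ∧ (∀ k, ν k ≤ 1) ∧
      ∃ OA ∈ Matrix.orthogonalGroup (Fin (m * 2)) ℝ,
      ∃ OB ∈ Matrix.orthogonalGroup (Fin (n * 2)) ℝ,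
        OA * blockA Γ * OAᵀ = canDiag m ν ∧
        directSum OA OB * Γ * (directSum OA OB)ᵀ = canonicalCov m n ν := by
  obtain ⟨AA, AB, BA, BB, hG⟩ : ∃ AA AB BA BB, Γ.submatrix (splitIndex m n) (splitIndex m n) =
      Matrix.fromBlocks AA AB BA BB := ⟨_, _, _, _, (Matrix.fromBlocks_toBlocks _).symm⟩
  have hblock : blockA Γ = AA := by
    ext i j
    exact congrFun (congrFun hG (Sum.inl i)) (Sum.inl j)
  have hGt : (Matrix.fromBlocks AA AB BA BB)ᵀ = -Matrix.fromBlocks AA AB BA BB := by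
    rw [← hG, Matrix.transpose_submatrix, ht]
    rfl
  have hGs : Matrix.fromBlocks AA AB BA BB * Matrix.fromBlocks AA AB BA BB = -1 := by
    rw [← hG, Matrix.submatrix_mul_equiv, hs, Matrix.submatrix_neg]
    simp
  rw [Matrix.fromBlocks_transpose, Matrix.fromBlocks_neg, Matrix.fromBlocks_inj] at hGt
  obtain ⟨tAA, -, tAB, tBB⟩ := hGt
  have hBA : BA = -ABᵀ := by rw [tAB, neg_neg]
  rw [Matrix.fromBlocks_multiply, ← Matrix.fromBlocks_one, Matrix.fromBlocks_neg,
    Matrix.fromBlocks_inj, hBA] at hGs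
  obtain ⟨s11, s12, s21, s22⟩ := hGs
  have hsplit : IsSkewSplit (Matrix.toEuclideanLin AA) (Matrix.toEuclideanLin ABᵀ)
      (Matrix.toEuclideanLin AB) (Matrix.toEuclideanLin BB) := by
    refine ⟨fun x y => ?_, fun x y => ?_, inner_toEuclideanLin_transpose AB, fun x => ?_,
      fun y => ?_, fun x => ?_, fun y => ?_⟩
    · rw [← neg_neg AA, ← tAA, ← Matrix.transpose_neg, inner_toEuclideanLin_transpose, map_neg,
        LinearMap.neg_apply, inner_neg_right, Matrix.transpose_neg, tAA, neg_neg]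
    · rw [← neg_neg BB, ← tBB, ← Matrix.transpose_neg, inner_toEuclideanLin_transpose, map_neg,
        LinearMap.neg_apply, inner_neg_right, Matrix.transpose_neg, tBB, neg_neg]
    · have e : AA * AA = AB * ABᵀ - 1 := by
        rw [Matrix.mul_neg, ← sub_eq_add_neg, sub_eq_iff_eq_add] at s11
        rw [s11]
        abel
      ext i
      simp [Matrix.toLpLin_apply, Matrix.mulVec_mulVec, e, Matrix.sub_mulVec]
    · have e : BB * BB = ABᵀ * AB - 1 := by
        rw [Matrix.neg_mul, neg_add_eq_iff_eq_add] at s22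
        rw [s22]
        abel
      ext i
      simp [Matrix.toLpLin_apply, Matrix.mulVec_mulVec, e, Matrix.sub_mulVec]
    · have e : BB * ABᵀ = -(ABᵀ * AA) := by
        rw [Matrix.neg_mul, Matrix.mul_neg, neg_zero, ← neg_add, neg_eq_zero] at s21
        exact eq_neg_of_add_eq_zero_right s21
      ext i
      simp [Matrix.toLpLin_apply, Matrix.mulVec_mulVec, e, Matrix.neg_mulVec]
    · have e : AA * AB = -(AB * BB) := by
        rw [neg_zero] at s12
        exact eq_neg_of_add_eq_zero_left s12
      ext i
      simp [Matrix.toLpLin_apply, Matrix.mulVec_mulVec, e, Matrix.neg_mulVec]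
  obtain ⟨ν, a, b, hν, hν1, ha, hb, haA, hbB, hab⟩ :=
    hsplit.exists_normalForm m n (by simp) (by simp)
  have hpad : ∀ k, padOne (fun k : Fin (min m n) => ν k) k = ν k := fun k => by
    rw [padOne]
    split_ifs with hk
    · rfl
    · exact (hν1 k (not_lt.mp hk)).symm
  have eAA : rowMatrix a * AA * (rowMatrix a)ᵀ = canDiag m fun k : Fin (min m n) => ν k := by
    ext p q
    obtain ⟨⟨k, i⟩, rfl⟩ := finProdFinEquiv.surjective p
    obtain ⟨⟨l, j⟩, rfl⟩ := finProdFinEquiv.surjective q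
    rw [mul_mul_transpose_apply, rowMatrix_apply, rowMatrix_apply, ← inner_toEuclideanLin,
      haA k l i j]
    simp [canDiag, hpad, Matrix.diagonal_apply]
  have eBB : rowMatrix b * BB * (rowMatrix b)ᵀ = canDiag n fun k : Fin (min m n) => ν k := by
    ext p q
    obtain ⟨⟨k, i⟩, rfl⟩ := finProdFinEquiv.surjective p
    obtain ⟨⟨l, j⟩, rfl⟩ := finProdFinEquiv.surjective q
    rw [mul_mul_transpose_apply, rowMatrix_apply, rowMatrix_apply, ← inner_toEuclideanLin,
      hbB k l i j]
    simp [canDiag, hpad, Matrix.diagonal_apply]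
  have eAB : rowMatrix a * AB * (rowMatrix b)ᵀ = canOff m n fun k : Fin (min m n) => ν k := by
    ext p q
    obtain ⟨⟨k, i⟩, rfl⟩ := finProdFinEquiv.surjective p
    obtain ⟨⟨l, j⟩, rfl⟩ := finProdFinEquiv.surjective q
    rw [mul_mul_transpose_apply, rowMatrix_apply, rowMatrix_apply, ← inner_toEuclideanLin,
      hab k l i j]
    simp [canOff, hpad]
  refine ⟨fun k => ν k, fun k => (hν k).1, fun k => (hν k).2, rowMatrix a, ha.rowMatrix_mem,
    rowMatrix b, hb.rowMatrix_mem, hblock ▸ eAA, ?_⟩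
  have hΓ : Γ = Matrix.reindex (splitIndex m n) (splitIndex m n)
      (Matrix.fromBlocks AA AB BA BB) := by
    rw [← hG]
    simp
  rw [hΓ, directSum, canonicalCov, Matrix.transpose_reindex, Matrix.reindex_apply,
    Matrix.reindex_apply, Matrix.reindex_apply, Matrix.submatrix_mul_equiv,
    Matrix.submatrix_mul_equiv, Matrix.reindex_apply, Matrix.fromBlocks_transpose,
    Matrix.fromBlocks_multiply, Matrix.fromBlocks_multiply, ← eAA, ← eBB, ← eAB, hBA]
  simp [Matrix.mul_assoc]

/-! ### The spectrum of the reduced covariance matrix -/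

lemma prod_append_const {M : Type*} [CommMonoid M] {r s : ℕ} (hrs : r ≤ s) (g : Fin s → M)
    (f : Fin r → M) (c : M) (h1 : ∀ (k : Fin s) (hk : (k : ℕ) < r), g k = f ⟨k, hk⟩)
    (h2 : ∀ k : Fin s, ¬ (k : ℕ) < r → g k = c) : ∏ k, g k = (∏ k, f k) * c ^ (s - r) := by
  obtain ⟨t, rfl⟩ := Nat.exists_eq_add_of_le hrs
  rw [Fin.prod_univ_add, Nat.add_sub_cancel_left]
  congr 1
  · exact Finset.prod_congr rfl fun k _ => h1 _ k.isLt
  · rw [Finset.prod_congr rfl fun k _ => h2 (Fin.natAdd r k) (by simp), Finset.prod_const,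
      Finset.card_univ, Fintype.card_fin]

/-- Each block `iνJ` has trace `0` and determinant `-ν²`. -/
lemma charpoly_canDiag (p : ℕ) {r : ℕ} (ν : Fin r → ℝ) :
    (Complex.I • (canDiag p ν).map Complex.ofReal).charpoly =
      ∏ k : Fin p, (Polynomial.X - Polynomial.C (padOne ν k : ℂ)) *
        (Polynomial.X + Polynomial.C (padOne ν k : ℂ)) := by
  -- `Matrix.blockDiagonal` puts the block index second, hence the swap of factors.
  have e : Complex.I • (canDiag p ν).map Complex.ofReal =
      Matrix.reindex ((Equiv.prodComm _ _).trans finProdFinEquiv)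
        ((Equiv.prodComm _ _).trans finProdFinEquiv) (Matrix.blockDiagonal fun k : Fin p =>
          (Complex.I * padOne ν k) • matJ.map Complex.ofReal) := by
    ext x y
    obtain ⟨⟨k, i⟩, rfl⟩ := finProdFinEquiv.surjective x
    obtain ⟨⟨l, j⟩, rfl⟩ := finProdFinEquiv.surjective y
    by_cases h : k = l
    · simp [canDiag, Matrix.blockDiagonal_apply, h, mul_assoc]
    · simp [canDiag, Matrix.blockDiagonal_apply, h]
  have e' : ∀ M : Fin p → Matrix (Fin 2) (Fin 2) ℂ, (Matrix.blockDiagonal M).charmatrix =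
      Matrix.blockDiagonal fun k => (M k).charmatrix := fun M => by
    ext ⟨i, k⟩ ⟨j, l⟩ : 2
    by_cases h : k = l <;>
    simp [Matrix.charmatrix_apply, Matrix.blockDiagonal_apply, Matrix.diagonal_apply, h]
  rw [e, Matrix.charpoly_reindex, Matrix.charpoly, e', Matrix.det_blockDiagonal]
  refine Finset.prod_congr rfl fun k _ => ?_
  change Matrix.charpoly _ = _
  rw [Matrix.charpoly_fin_two]
  have h1 : Matrix.trace ((Complex.I * padOne ν k) • matJ.map Complex.ofReal) = 0 := by
    simp [Matrix.trace_fin_two, matJ]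
  have h2 : Matrix.det ((Complex.I * padOne ν k) • matJ.map Complex.ofReal) =
      -(padOne ν k * padOne ν k : ℂ) := by
    simp [Matrix.det_fin_two, matJ]
    linear_combination (padOne ν k * padOne ν k : ℂ) * Complex.I_mul_I
  rw [h1, h2]
  simp
  ring

/-- Orthogonal conjugation preserves the characteristic polynomial; the padded entries `1` supply
the extra pairs `±1`. -/
lemma isPositiveSpectrum_of_canDiag {m r : ℕ} (hr : r ≤ m)
    {M O : Matrix (Fin (m * 2)) (Fin (m * 2)) ℝ}
    (hO : O ∈ Matrix.orthogonalGroup (Fin (m * 2)) ℝ) {ν : Fin r → ℝ} (hν : ∀ k, 0 ≤ ν k)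
    (h : O * M * Oᵀ = canDiag m ν) : IsPositiveSpectrum M ν := by
  refine ⟨hν, ?_⟩
  have hOO : Oᵀ * O = 1 := by
    have := Matrix.mem_unitaryGroup_iff'.mp hO
    rwa [Matrix.star_eq_conjTranspose, Matrix.conjTranspose_eq_transpose_of_trivial] at this
  have hmap : ∀ P Q : Matrix (Fin (m * 2)) (Fin (m * 2)) ℝ,
      (P * Q).map Complex.ofReal = P.map Complex.ofReal * Q.map Complex.ofReal :=
    fun P Q => Matrix.map_mul (f := Complex.ofRealHom)
  have hOOc : Oᵀ.map Complex.ofReal * O.map Complex.ofReal = 1 := by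
    rw [← hmap, hOO]
    simp
  have e : Complex.I • (canDiag m ν).map Complex.ofReal =
      O.map Complex.ofReal * ((Complex.I • M.map Complex.ofReal) * Oᵀ.map Complex.ofReal) := by
    rw [← h, hmap, hmap]
    simp [mul_assoc]
  have hc : (Complex.I • M.map Complex.ofReal).charpoly =
      (Complex.I • (canDiag m ν).map Complex.ofReal).charpoly := by
    rw [e, Matrix.charpoly_mul_comm, mul_assoc, hOOc, mul_one]
  rw [hc, charpoly_canDiag]
  refine prod_append_const hr _ (fun k => _) _ (fun k hk => ?_) fun k hk => ?_
  · rw [padOne, dif_pos hk]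
  · rw [padOne, dif_neg hk]
    simp

/-! ### Attainment of the minimum -/

/-- The group is closed and its entries lie in the unit disc. -/
lemma isCompact_unitaryGroup (ι : Type*) [Fintype ι] [DecidableEq ι] :
    IsCompact (Matrix.unitaryGroup ι ℂ : Set (Matrix ι ι ℂ)) := by
  have hK : IsCompact (Set.univ.pi fun _ => Set.univ.pi fun _ => Metric.closedBall 0 1 :
      Set (ι → ι → ℂ)) :=
    isCompact_univ_pi fun _ => isCompact_univ_pi fun _ => isCompact_closedBall 0 1
  refine IsCompact.of_isClosed_subset hK ?_ ?_
  · have : (Matrix.unitaryGroup ι ℂ : Set (Matrix ι ι ℂ)) = {U | U * star U = 1} := by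
      ext U
      exact Matrix.mem_unitaryGroup_iff
    rw [this]
    exact isClosed_eq (continuous_id.mul continuous_star) continuous_const
  · intro U hU i _ j _
    simpa using entry_norm_bound_of_unitary hU i j

/-- The identity string keeps the argument of the logarithm positive on the whole orbit. -/
lemma trace_pauliString_zero {L : ℕ} (ψ : Bits L → ℂ) (hψ : star ψ ⬝ᵥ ψ = 1) :
    Matrix.trace (pureDensity ψ * pauliString fun _ => 0) = 1 := by
  have : pauliString (fun _ : Fin L => 0) = 1 := siteTensor_one
  rw [this, trace_pureDensity_mul, expect, Matrix.one_mulVec, hψ]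

theorem isLeast_nonlocalSRE {m n : ℕ} {α : ℝ} (hα : 0 < α) (ψ : Bits (m + n) → ℂ)
    (hψ : star ψ ⬝ᵥ ψ = 1) : IsLeast (localOrbitSRE α ψ) (nonlocalSRE α ψ) := by
  set K : Set (Matrix (Bits m) (Bits m) ℂ × Matrix (Bits n) (Bits n) ℂ) :=
    (Matrix.unitaryGroup (Bits m) ℂ : Set _) ×ˢ (Matrix.unitaryGroup (Bits n) ℂ : Set _) with hK
  set ρ : Matrix (Bits m) (Bits m) ℂ × Matrix (Bits n) (Bits n) ℂ → Matrix _ _ ℂ :=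
    fun U => pureDensity (localOp U.1 U.2 *ᵥ ψ) with hρ
  have himage : localOrbitSRE α ψ = (fun U => sre α (ρ U)) '' K := by
    ext x
    constructor
    · rintro ⟨UA, hA, UB, hB, rfl⟩
      exact ⟨(UA, UB), ⟨hA, hB⟩, rfl⟩
    · rintro ⟨⟨UA, UB⟩, ⟨hA, hB⟩, rfl⟩
      exact ⟨UA, hA, UB, hB, rfl⟩
  have hloc : Continuous fun U : Matrix (Bits m) (Bits m) ℂ × Matrix (Bits n) (Bits n) ℂ =>
      localOp U.1 U.2 := by
    refine continuous_matrix fun a b => ?_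
    exact (continuous_fst.matrix_elem _ _).mul (continuous_snd.matrix_elem _ _)
  have hvec : Continuous fun U : Matrix (Bits m) (Bits m) ℂ × Matrix (Bits n) (Bits n) ℂ =>
      localOp U.1 U.2 *ᵥ ψ := hloc.matrix_mulVec continuous_const
  have hρc : Continuous ρ := hvec.matrix_vecMulVec (continuous_star.comp hvec)
  have hnorm : ∀ U ∈ K, star (localOp U.1 U.2 *ᵥ ψ) ⬝ᵥ (localOp U.1 U.2 *ᵥ ψ) = 1 := by
    rintro ⟨UA, UB⟩ ⟨hA, hB⟩
    rw [Matrix.star_mulVec, ← Matrix.dotProduct_mulVec, Matrix.mulVec_mulVec,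
      ← Matrix.star_eq_conjTranspose,
      Matrix.mem_unitaryGroup_iff'.mp (localOp_mem_unitaryGroup hA hB), Matrix.one_mulVec, hψ]
  have hcont : ContinuousOn (fun U => sre α (ρ U)) K := by
    refine ContinuousOn.sub (continuousOn_const.mul (ContinuousOn.log ?_ ?_)) continuousOn_const
    · refine (continuous_finsetSum _ fun P _ => ?_).continuousOn
      -- Expectations may vanish on the orbit; the power is still continuous there because `α` is
      -- positive.
      refine Continuous.rpow_const ?_ fun _ => Or.inr hα.le
      exact ((hρc.matrix_mul continuous_const).matrix_trace.norm.pow 2).div_const _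
    · intro U hU
      refine ne_of_gt (Finset.sum_pos' (fun P _ => by positivity) ⟨fun _ => 0, Finset.mem_univ _, ?_⟩)
      rw [hρ, trace_pauliString_zero _ (hnorm U hU), norm_one]
      positivity
  rw [nonlocalSRE, himage]
  refine (((isCompact_unitaryGroup _).prod (isCompact_unitaryGroup _)).image_of_continuousOn
    hcont).isLeast_sInf ?_
  exact ⟨_, (1, 1), ⟨one_mem _, one_mem _⟩, rfl⟩

end FermionMagic

theorem mainTheorem1 (m n : ℕ) (ψ : Bits (m + n) → ℂ) (hψ : IsPureGaussian ψ) :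
    ∃ ν : Fin (min m n) → ℝ,
      (∀ k, ν k ≤ 1) ∧
      IsPositiveSpectrum (blockA (covariance (pureDensity ψ))) ν ∧
      ∃ OA ∈ Matrix.orthogonalGroup (Fin (m * 2)) ℝ,
      ∃ OB ∈ Matrix.orthogonalGroup (Fin (n * 2)) ℝ,
      ∃ UA ∈ Matrix.unitaryGroup (Bits m) ℂ,
      ∃ UB ∈ Matrix.unitaryGroup (Bits n) ℂ,
        directSum OA OB * covariance (pureDensity ψ) * (directSum OA OB)ᵀ
          = canonicalCov m n ν ∧
        RotatesMajoranas (localOp UA UB) (directSum OA OB) ∧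
        covariance (pureDensity (localOp UA UB *ᵥ ψ)) = canonicalCov m n ν ∧
        ∀ α : ℝ, 0 < α →
          stringMoment α (pureDensity (localOp UA UB *ᵥ ψ))
            = pfaffianMoment α (canonicalCov m n ν) ∧
          pfaffianMoment α (canonicalCov m n ν)
            = 2 ^ (max m n) * ∏ k, (1 + ν k ^ (2 * α) + √(1 - ν k ^ 2) ^ (2 * α)) ∧
          (α ≠ 1 →
            sre α (pureDensity (localOp UA UB *ᵥ ψ)) = sreCov α (canonicalCov m n ν) ∧
            sreCov α (canonicalCov m n ν)
              = 1 / (1 - α) *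
                  ∑ k, Real.log ((1 + ν k ^ (2 * α) + √(1 - ν k ^ 2) ^ (2 * α)) / 2) ∧
            IsLeast (localOrbitSRE α ψ) (nonlocalSRE α ψ) ∧
            nonlocalSRE α ψ ≤ sreCov α (canonicalCov m n ν)) := by
  obtain ⟨Γ, hΓ⟩ := hψ.exists_isGaussianWith
  rw [hΓ.covariance_eq]
  obtain ⟨ν, hν0, hν1, OA, hOA, OB, hOB, hblock, hcan⟩ :=
    exists_canonicalCov hΓ.transpose_eq hΓ.mul_self
  obtain ⟨UA, hUA, UB, hUB, hrot⟩ := exists_localOp_rotatesMajoranas hOA hOB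
  -- The annihilation relations of the rotated state hold with the canonical matrix itself, and all
  -- remaining claims are read off from them.
  have hG : IsGaussianWith (localOp UA UB *ᵥ ψ) (canonicalCov m n ν) :=
    hcan ▸ hΓ.rotate (localOp_mem_unitaryGroup hUA hUB) (directSum_mem_orthogonalGroup hOA hOB) hrot
  refine ⟨ν, hν1, isPositiveSpectrum_of_canDiag (min_le_left m n) hOA hν0 hblock, OA, hOA, OB, hOB,
    UA, hUA, UB, hUB, hcan, hrot, hG.covariance_eq, fun α hα => ⟨hG.stringMoment_eq α,
    hG.pfaffianMoment_canonical hν0 hν1 hα, fun hα1 => ?_⟩⟩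
  have hleast := isLeast_nonlocalSRE hα ψ hΓ.norm_eq
  exact ⟨hG.sre_eq_sreCov α, hG.sreCov_canonical hν0 hν1 hα hα1, hleast,
    hleast.2 ⟨UA, hUA, UB, hUB, (hG.sre_eq_sreCov α).symm⟩⟩
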